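/- Let $d,N\ge 1$ be integers. For $k\ge1$ let $c_k(x_1,\dots,x_k)=\sum_{1\le i<j\le k}\frac1{|x_i-x_j|}\in[0,+\infty]$ on $(\mathbb R^d)^k$ (so $c_1=0$, and $c_k=+\infty$ if two points coincide). For a nonnegative Borel measure $\mu$ on $\mathbb R^d$ with mass $\|\mu\|\le1$ set $$\mathcal C_k(\mu)=\inf\Big\{\int c_k\,dP\ :\ P \text{ a nonnegative Borel measure on } (\mathbb R^d)^k \text{ whose } k \text{ marginals all equal } \mu\Big\},$$ and for $\varphi\in C_0=C_0(\mathbb R^d)$ (continuous functions vanishing at infinity) set $$M_k(\varphi)=\sup_{x\in(\mathbb R^d)^k}\Big\{\frac1k\sum_{i=1}^k\varphi(x_i)-c_k(x_1,\dots,x_k)\Big\}.$$ Let also $\overline C(\rho)=\inf\{\liminf_n \mathcal C_N(\rho_n)\}$, the infimum being over all sequences of Borel probability measures $\rho_n$ converging to $\rho$ weakly* in duality with $C_0$. **Theorem.** Let $\rho$ be a nonnegative Borel measure on $\mathbb R^d$ with $1/N<\|\rho\|\le1$, and let $\rho_1,\dots,\rho_N$ be nonnegative Borel measures with $\sum_{k=1}^N\frac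 kN\rho_k=\rho$ and $\sum_{k=1}^N\|\rho_k\|\le1$ (an admissible decomposition of $\rho$). Call $\{\rho_k\}$ optimal if it minimizes $\sum_{k=1}^N\mathcal C_k(\rho_k)$ among all admissible decompositions of $\rho$. (a) Let $\varphi\in C_0$. Then $\{\rho_k\}$ is optimal and $\varphi$ maximizes $\int\psi\,d\rho-M_N(\psi)$ over $\psi\in C_0$ if and only if the following three conditions hold: i) $\sum_{k=1}^N\|\rho_k\|=1$; ii) for every $k\in\{1,\dots,N\}$, $\frac{k\varphi}N$ maximizes $\int\psi\,d\rho_k-M_k(\psi)\|\rho_k\|$ over $\psi\in C_0$; iii) $M_k\big(\frac{k\varphi}N\big)=M_N(\varphi)$ for every $k\in\{1,\dots,N\}$ for which there is $1\le l\le k$ with $\|\rho_l\|>0$. (b) Let $(\varphi_n)$ be a sequence in $C_0$, and consider the conditions i') $\sum_{k=1}^N\|\rho_k\|=1$; ii') for every $k\in\{1,\dots,N\}$, $\big(\frac{k\varphi_n}N\big)_n$ is a maximizing sequence for $\int\psi\,d\rho_k-M_k(\psi)\|\rho_k\|$ over $\psi\in C_0$; iii') $M_N(\varphi_n)-M_k\big(\frac{k\varphi_n}N\big)\to0$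 as $n\to\infty$ for every $k\in\{1,\dots,N\}$ for which there is $1\le l\le k$ with $\|\rho_l\|>0$. If i'), ii'), iii') hold, then $\{\rho_k\}$ is optimal and $(\varphi_n)$ is a maximizing sequence for $\int\psi\,d\rho-M_N(\psi)$ over $\psi\in C_0$. Conversely, if $\overline C(\rho)<+\infty$, $\{\rho_k\}$ is optimal and $(\varphi_n)$ is a maximizing sequence for $\int\psi\,d\rho-M_N(\psi)$, then i'), ii'), iii') hold. (A sequence is maximizing for a functional if the values of the functional along it converge in $[-\infty,+\infty]$ to its supremum, which may be $+\infty$.) -/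

import Mathlib

open MeasureTheory Filter Topology
open scoped ENNReal ZeroAtInfty

noncomputable section

namespace RelaxedCost

/-- The space `ℝ^d` with its Euclidean norm. -/
abbrev E (d : ℕ) : Type := EuclideanSpace ℝ (Fin d)

/-- The Coulomb cost `c_k(x₁, …, x_k) = ∑_{i<j} 1 / |x_i - x_j|`, with values in `[0, ∞]`
(it is `∞` as soon as two of the points coincide, and `c_1 = 0`). -/
def coulomb {d : ℕ} (k : ℕ) (x : Fin k → E d) : ℝ≥0∞ :=
  ∑ i : Fin k, ∑ j ∈ Finset.Ioi i, (edist (x i) (x j))⁻¹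

/-- The partial interaction cost `𝒞_k(μ)`: the infimum of `∫ c_k dP` over the nonnegative Borel
measures `P` on `(ℝ^d)^k` all of whose `k` marginals are equal to `μ`. -/
def partialCost {d : ℕ} (k : ℕ) (μ : Measure (E d)) : ℝ≥0∞ :=
  ⨅ P ∈ {P : Measure (Fin k → E d) | ∀ i : Fin k, P.map (fun x => x i) = μ},
    ∫⁻ x, coulomb k x ∂P

/-- Weak* convergence of measures, in duality with `C₀(ℝ^d)`. -/
def WeakStarTendsto {d : ℕ} (ν : ℕ → Measure (E d)) (ρ : Measure (E d)) : Prop :=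
  ∀ φ : C₀(E d, ℝ), Tendsto (fun n => ∫ x, φ x ∂(ν n)) atTop (𝓝 (∫ x, φ x ∂ρ))

/-- The relaxed cost `C̄(ρ) = inf { liminf C(ρ_n) : ρ_n → ρ weakly*, ρ_n probabilities }`, where
`C = 𝒞_N` on probabilities. -/
def relaxedCost {d : ℕ} (N : ℕ) (ρ : Measure (E d)) : ℝ≥0∞ :=
  ⨅ ν ∈ {ν : ℕ → Measure (E d) | (∀ n, IsProbabilityMeasure (ν n)) ∧ WeakStarTendsto ν ρ},
    liminf (fun n => partialCost N (ν n)) atTop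

/-- `(ρ_k)_{1 ≤ k ≤ N}` is an admissible decomposition of `ρ`: `∑ (k/N) ρ_k = ρ` and
`∑ ‖ρ_k‖ ≤ 1`. Only the values of `r` at `1, …, N` matter. -/
def IsDecomposition {d : ℕ} (N : ℕ) (ρ : Measure (E d)) (r : ℕ → Measure (E d)) : Prop :=
  (∑ k ∈ Finset.Icc 1 N, ((k : ℝ≥0∞) / (N : ℝ≥0∞)) • r k = ρ) ∧
    ∑ k ∈ Finset.Icc 1 N, r k Set.univ ≤ 1

/-- The total cost `∑_{k=1}^N 𝒞_k(ρ_k)` of a decomposition. -/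
def stratifiedCost {d : ℕ} (N : ℕ) (r : ℕ → Measure (E d)) : ℝ≥0∞ :=
  ∑ k ∈ Finset.Icc 1 N, partialCost k (r k)

/-- `(ρ_k)` is an optimal decomposition: it is admissible and minimizes `∑ 𝒞_k(ρ_k)` among all
admissible decompositions of `ρ`. -/
def IsOptimalDecomposition {d : ℕ} (N : ℕ) (ρ : Measure (E d)) (r : ℕ → Measure (E d)) : Prop :=
  IsDecomposition N ρ r ∧
    ∀ r' : ℕ → Measure (E d), IsDecomposition N ρ r' → stratifiedCost N r ≤ stratifiedCost N r'

/-- `M_k(φ) = sup { (1/k) ∑ φ(x_i) - c_k(x₁, …, x_k) }`. The configurations of infinite cost, whose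
contribution would be `-∞`, are left out. For `k, d ≥ 1` the set below is nonempty, and it is
bounded above by `sup φ ∨ 0`, so that this is a genuine real supremum. -/
def M {d : ℕ} (k : ℕ) (φ : C₀(E d, ℝ)) : ℝ :=
  sSup {t : ℝ | ∃ x : Fin k → E d, coulomb k x ≠ ∞ ∧
    t = (1 / (k : ℝ)) * ∑ i : Fin k, φ (x i) - (coulomb k x).toReal}

/-- The functional `φ ↦ ∫ φ dρ - M_N(φ)` of the dual problem for `C̄(ρ)`. -/
def dualValue {d : ℕ} (N : ℕ) (ρ : Measure (E d)) (φ : C₀(E d, ℝ)) : ℝ :=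
  ∫ x, φ x ∂ρ - M N φ

/-- The functional `φ ↦ ∫ φ dμ - M_k(φ) ‖μ‖` of the dual problem for `𝒞_k(μ)`. -/
def partialDualValue {d : ℕ} (k : ℕ) (μ : Measure (E d)) (φ : C₀(E d, ℝ)) : ℝ :=
  ∫ x, φ x ∂μ - M k φ * μ.real Set.univ

/-- `φ` is optimal in the maximization over `C₀` of the functional `F`. -/
def IsOptimal {d : ℕ} (F : C₀(E d, ℝ) → ℝ) (φ : C₀(E d, ℝ)) : Prop :=
  ∀ ψ : C₀(E d, ℝ), F ψ ≤ F φ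

/-- `(φ_n)` is a maximizing sequence over `C₀` for the functional `F`; the supremum may be `+∞`. -/
def IsMaximizing {d : ℕ} (F : C₀(E d, ℝ) → ℝ) (φ : ℕ → C₀(E d, ℝ)) : Prop :=
  Tendsto (fun n => ((F (φ n) : ℝ) : EReal)) atTop (𝓝 (⨆ ψ : C₀(E d, ℝ), ((F ψ : ℝ) : EReal)))

/-- The three optimality conditions for a decomposition and a potential. -/
def OptimalityConditions {d : ℕ} (N : ℕ) (r : ℕ → Measure (E d)) (φ : C₀(E d, ℝ)) : Prop :=
  (∑ k ∈ Finset.Icc 1 N, r k Set.univ = 1) ∧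
  (∀ k ∈ Finset.Icc 1 N, IsOptimal (partialDualValue k (r k)) (((k : ℝ) / (N : ℝ)) • φ)) ∧
  (∀ k ∈ Finset.Icc 1 N, (∃ l ∈ Finset.Icc 1 k, 0 < r l Set.univ) →
    M k (((k : ℝ) / (N : ℝ)) • φ) = M N φ)

/-- The three optimality conditions for a decomposition and a sequence of potentials. -/
def AsymptoticOptimalityConditions {d : ℕ} (N : ℕ) (r : ℕ → Measure (E d))
    (φ : ℕ → C₀(E d, ℝ)) : Prop :=
  (∑ k ∈ Finset.Icc 1 N, r k Set.univ = 1) ∧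
  (∀ k ∈ Finset.Icc 1 N,
    IsMaximizing (partialDualValue k (r k)) (fun n => ((k : ℝ) / (N : ℝ)) • φ n)) ∧
  (∀ k ∈ Finset.Icc 1 N, (∃ l ∈ Finset.Icc 1 k, 0 < r l Set.univ) →
    Tendsto (fun n => M N (φ n) - M k (((k : ℝ) / (N : ℝ)) • φ n)) atTop (𝓝 0))

end RelaxedCost

end

noncomputable section

namespace RelaxedCost

/-! ### Sums over pairs -/

/-! The theorem is complementary slackness for a dual pair whose primal side is the minimization
over decompositions. For an admissible decomposition, `IsDecomposition.dualValue_eq` writes `∫ψ dρ -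
M_N(ψ)` as the sum of the partial dual values at `kψ/N`, minus the gaps `M_N(ψ) - M_k(kψ/N)`
weighted by `‖ρ_k‖`, minus `M_N(ψ)(1 - ∑‖ρ_k‖)`. The gaps are nonnegative because sending an extra
point to infinity costs nothing, so `M_k(kψ/N)` increases with `k` (`M_smul_succ_le`); also `M_N ≥
0`. With weak duality for each `𝒞_k`, a finite difference between the total cost and the dual value
is thus a sum of nonnegative defects. If there is no duality gap, optimality on both sides means
that all defects vanish (or tend to zero), which gives the three conditions. The mass condition also
needs `1/N < ‖ρ‖`: it makes the cost positive, which prevents `M_N(φ_n)` from tending to zero.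

Absence of a gap is `exists_decomposition_of_dual_bound`. On the one-point compactification, with
points at infinity not interacting, the Riesz extension theorem and the Riesz representation theorem
produce an `N`-point plan of cost at most the dual bound. Sorting its configurations by which points
are finite (`exists_decomposition`) yields the decomposition. Applied to the normalized `ρ_k`, this
gives strong duality for `𝒞_k` as well (`partialCost_le_of_dual_bound`).

Part (a) is part (b) for constant sequences. The relaxed cost enters only as an upper bound for the
dual values, which makes their supremum finite. -/

theorem two_mul_sum_Ioi {n : ℕ} (u : Fin n → Fin n → ℝ≥0∞) (hu : ∀ i j, u i j = u j i) :
    2 * ∑ i, ∑ j ∈ Finset.Ioi i, u i j = ∑ i, ∑ j, if i = j then 0 else u i j := by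
  have h1 : ∑ i, ∑ j ∈ Finset.Ioi i, u i j = ∑ i, ∑ j, if i < j then u i j else 0 := by
    refine Finset.sum_congr rfl fun i _ => ?_
    rw [← Finset.sum_filter]
    exact Finset.sum_congr (by ext j; simp) fun _ _ => rfl
  have h2 : ∑ i, ∑ j ∈ Finset.Ioi i, u i j = ∑ i, ∑ j, if j < i then u i j else 0 := by
    rw [h1, Finset.sum_comm]
    refine Finset.sum_congr rfl fun i _ => Finset.sum_congr rfl fun j _ => ?_
    rw [hu]
  rw [two_mul]
  nth_rw 1 [h1]
  rw [h2, ← Finset.sum_add_distrib]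
  refine Finset.sum_congr rfl fun i _ => ?_
  rw [← Finset.sum_add_distrib]
  refine Finset.sum_congr rfl fun j _ => ?_
  rcases lt_trichotomy i j with h | h | h
  · simp [h, h.ne, h.not_gt]
  · simp [h]
  · simp [h, h.ne', h.not_gt]

/-- The sum of a symmetric function over the pairs of a subfamily is at most the full sum. -/
theorem sum_Ioi_comp_le {k n : ℕ} (u : Fin n → Fin n → ℝ≥0∞) (hu : ∀ i j, u i j = u j i)
    (e : Fin k → Fin n) (he : Function.Injective e) :
    ∑ a, ∑ b ∈ Finset.Ioi a, u (e a) (e b) ≤ ∑ i, ∑ j ∈ Finset.Ioi i, u i j := by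
  have key : 2 * ∑ a, ∑ b ∈ Finset.Ioi a, u (e a) (e b) ≤
      2 * ∑ i, ∑ j ∈ Finset.Ioi i, u i j := by
    rw [two_mul_sum_Ioi _ hu, two_mul_sum_Ioi (fun a b => u (e a) (e b)) fun _ _ => hu _ _]
    have := ENNReal.tsum_comp_le_tsum_of_injective (he.prodMap he)
      (fun p : Fin n × Fin n => if p.1 = p.2 then 0 else u p.1 p.2)
    simpa [tsum_fintype, Fintype.sum_prod_type, he.eq_iff] using this
  exact (ENNReal.mul_le_mul_iff_right (by simp) (by simp)).1 key

/-! ### The Coulomb cost -/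

variable {d : ℕ}

theorem measurable_coulomb (k : ℕ) : Measurable (coulomb (d := d) k) := by
  unfold coulomb
  refine Finset.measurable_fun_sum _ fun i _ => Finset.measurable_fun_sum _ fun j _ => ?_
  exact ((measurable_pi_apply i).edist (measurable_pi_apply j)).inv

theorem coulomb_comp_le {k n : ℕ} (x : Fin n → E d) (e : Fin k → Fin n)
    (he : Function.Injective e) : coulomb k (fun i => x (e i)) ≤ coulomb n x :=
  sum_Ioi_comp_le (fun i j => (edist (x i) (x j))⁻¹) (fun i j => by rw [edist_comm]) e he

theorem coulomb_ne_top {k : ℕ} {x : Fin k → E d} (hx : Function.Injective x) :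
    coulomb k x ≠ ∞ := by
  simp only [coulomb, ne_eq, ENNReal.sum_eq_top, Finset.mem_univ, true_and, not_exists, not_and,
    Finset.mem_Ioi, ENNReal.inv_eq_top, edist_eq_zero]
  exact fun i j hij h => hij.ne (hx h)

theorem coulomb_cons {k : ℕ} (y : E d) (x : Fin k → E d) :
    coulomb (k + 1) (Fin.cons y x : Fin (k + 1) → E d) =
      ∑ j, (edist y (x j))⁻¹ + coulomb k x := by
  simp only [coulomb, Fin.sum_univ_succ, Fin.Ioi_zero_eq_map, Fin.Ioi_succ, Finset.sum_map,
    Fin.coe_succEmb, Fin.cons_zero, Fin.cons_succ]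

/-- A point sent to infinity stops interacting with the others. -/
theorem tendsto_coulomb_cons {k : ℕ} (x : Fin k → E d) :
    Tendsto (fun y => coulomb (k + 1) (Fin.cons y x : Fin (k + 1) → E d)) (cocompact (E d))
      (𝓝 (coulomb k x)) := by
  simp only [coulomb_cons]
  have : Tendsto (fun y => ∑ j, (edist y (x j))⁻¹) (cocompact (E d)) (𝓝 (∑ _j : Fin k, 0)) := by
    refine tendsto_finsetSum _ fun j _ => ?_
    rw [← ENNReal.inv_top]
    refine tendsto_inv_iff.2 ?_
    simp only [edist_dist]
    exact ENNReal.tendsto_ofReal_atTop.comp (tendsto_dist_right_cocompact_atTop _)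
  simpa using this.add (tendsto_const_nhds (x := coulomb k x))

/-! ### The functional `M` -/

theorem bddAbove_M (k : ℕ) (φ : C₀(E d, ℝ)) :
    BddAbove {t : ℝ | ∃ x : Fin k → E d, coulomb k x ≠ ∞ ∧
      t = (1 / (k : ℝ)) * ∑ i : Fin k, φ (x i) - (coulomb k x).toReal} := by
  refine ⟨‖φ.toBCF‖, ?_⟩
  rintro t ⟨x, -, rfl⟩
  have h1 : ∑ i : Fin k, φ (x i) ≤ k * ‖φ.toBCF‖ := by
    refine (Finset.sum_le_sum fun i _ => (le_abs_self _).trans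
      (φ.toBCF.norm_coe_le_norm (x i))).trans ?_
    simp
  have h2 : (1 / (k : ℝ)) * ∑ i : Fin k, φ (x i) ≤ ‖φ.toBCF‖ := by
    rcases Nat.eq_zero_or_pos k with rfl | hk
    · simp
    · have : (0 : ℝ) < k := by exact_mod_cast hk
      rw [one_div, inv_mul_le_iff₀ this]
      exact h1
  have := (coulomb k x).toReal_nonneg
  linarith

theorem le_M {k : ℕ} (φ : C₀(E d, ℝ)) {x : Fin k → E d} (hx : coulomb k x ≠ ∞) :
    (1 / (k : ℝ)) * ∑ i : Fin k, φ (x i) - (coulomb k x).toReal ≤ M k φ :=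
  le_csSup (bddAbove_M k φ) ⟨x, hx, rfl⟩

section Nontrivial

variable [Nontrivial (E d)]

/-- A nontrivial real vector space is infinite, so there are configurations of distinct points,
whose cost is finite. Without this, `sSup ∅ = 0` could exceed `a`. -/
theorem M_le {k : ℕ} {φ : C₀(E d, ℝ)} {a : ℝ}
    (h : ∀ x : Fin k → E d, coulomb k x ≠ ∞ →
      (1 / (k : ℝ)) * ∑ i : Fin k, φ (x i) - (coulomb k x).toReal ≤ a) : M k φ ≤ a := by
  have : Infinite (E d) := Module.Free.infinite ℝ (E d)
  refine csSup_le ?_ ?_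
  · refine ⟨_, fun i : Fin k => Infinite.natEmbedding (E d) i, coulomb_ne_top ?_, rfl⟩
    exact (Infinite.natEmbedding (E d)).injective.comp Fin.val_injective
  · rintro t ⟨x, hx, rfl⟩
    exact h x hx

theorem M_zero_le (k : ℕ) : M (d := d) k 0 ≤ 0 := M_le fun x _ => by simp

/-- With the factor `k` the average becomes the plain sum `∑ ψ(x_i)`. Adding a point `y → ∞` to a
competitor for `k` points changes neither this sum nor the cost in the limit, since `ψ` vanishes at
infinity. -/
theorem M_smul_succ_le {k : ℕ} (hk : 1 ≤ k) (ψ : C₀(E d, ℝ)) :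
    M k ((k : ℝ) • ψ) ≤ M (k + 1) (((k + 1 : ℕ) : ℝ) • ψ) := by
  have : NoncompactSpace (E d) := NormedSpace.noncompactSpace ℝ (E d)
  have hk0 : (k : ℝ) ≠ 0 := by positivity
  have hk1 : ((k + 1 : ℕ) : ℝ) ≠ 0 := by positivity
  refine M_le fun x hx => ?_
  have hlim : Tendsto (fun y => (ψ y + ∑ i, ψ (x i)) -
      (coulomb (k + 1) (Fin.cons y x : Fin (k + 1) → E d)).toReal) (cocompact (E d))
      (𝓝 ((0 + ∑ i, ψ (x i)) - (coulomb k x).toReal)) :=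
    ((zero_at_infty ψ).add tendsto_const_nhds).sub
      ((ENNReal.tendsto_toReal hx).comp (tendsto_coulomb_cons x))
  have hev : ∀ᶠ y in cocompact (E d),
      coulomb (k + 1) (Fin.cons y x : Fin (k + 1) → E d) ≠ ∞ :=
    (tendsto_coulomb_cons x).eventually_ne hx
  have h1 : (1 / (k : ℝ)) * ∑ i : Fin k, ((k : ℝ) • ψ) (x i) = 0 + ∑ i, ψ (x i) := by
    simp only [ZeroAtInftyContinuousMap.smul_apply, smul_eq_mul, ← Finset.mul_sum]
    field_simp
    ring
  rw [h1]
  refine le_of_tendsto hlim ?_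
  filter_upwards [hev] with y hy
  refine le_trans (le_of_eq ?_) (le_M _ hy)
  congr 1
  simp only [ZeroAtInftyContinuousMap.smul_apply, smul_eq_mul, ← Finset.mul_sum,
    Fin.sum_univ_succ, Fin.cons_zero, Fin.cons_succ]
  field_simp

theorem M_smul_mono {k n : ℕ} (hk : 1 ≤ k) (hkn : k ≤ n) (ψ : C₀(E d, ℝ)) :
    M k ((k : ℝ) • ψ) ≤ M n ((n : ℝ) • ψ) := by
  induction n, hkn using Nat.le_induction with
  | base => exact le_rfl
  | succ n hn ih => exact ih.trans (M_smul_succ_le (hk.trans hn) ψ)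

theorem M_div_smul_mono {k l N : ℕ} (hk : 1 ≤ k) (hkl : k ≤ l) (φ : C₀(E d, ℝ)) :
    M k (((k : ℝ) / N) • φ) ≤ M l (((l : ℝ) / N) • φ) := by
  simpa only [div_eq_mul_inv, mul_smul] using M_smul_mono hk hkl ((N : ℝ)⁻¹ • φ)

theorem M_div_smul_le {k N : ℕ} (hk : 1 ≤ k) (hkN : k ≤ N) (φ : C₀(E d, ℝ)) :
    M k (((k : ℝ) / N) • φ) ≤ M N φ := by
  have hN : (N : ℝ) ≠ 0 := by have := hk.trans hkN; positivity
  simpa [div_self hN] using M_div_smul_mono (N := N) hk hkN φ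

/-- This is the monotonicity compared with one point, where the cost is zero. -/
theorem apply_le_mul_M {N : ℕ} (hN : 1 ≤ N) (φ : C₀(E d, ℝ)) (x : E d) : φ x ≤ N * M N φ := by
  have h0 : coulomb 1 (fun _ : Fin 1 => x) ≠ ∞ := coulomb_ne_top fun i j _ => Subsingleton.elim i j
  have h1 := (le_M (((1 : ℕ) / (N : ℝ)) • φ) h0).trans (M_div_smul_le le_rfl hN φ)
  have hN' : (0 : ℝ) < N := by exact_mod_cast hN
  have h2 : coulomb 1 (fun _ : Fin 1 => x) = 0 := by simp [coulomb]
  simp [h2] at h1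
  rwa [inv_mul_le_iff₀ hN'] at h1

theorem M_nonneg {N : ℕ} (hN : 1 ≤ N) (φ : C₀(E d, ℝ)) : 0 ≤ M N φ := by
  have : NoncompactSpace (E d) := NormedSpace.noncompactSpace ℝ (E d)
  have hN' : (0 : ℝ) < N := by exact_mod_cast hN
  have : 0 ≤ N * M N φ :=
    le_of_tendsto (zero_at_infty φ) (Eventually.of_forall (apply_le_mul_M hN φ))
  exact nonneg_of_mul_nonneg_right this hN'

end Nontrivial

theorem integrable_zeroAtInfty (μ : Measure (E d)) [IsFiniteMeasure μ] (ψ : C₀(E d, ℝ)) :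
    Integrable ψ μ := ψ.toBCF.integrable μ

/-! ### Elementary properties of the partial costs -/

/-- Weak duality. -/
theorem partialDualValue_le {k : ℕ} (hk : 1 ≤ k) (μ : Measure (E d)) [IsFiniteMeasure μ]
    (ψ : C₀(E d, ℝ)) : ENNReal.ofReal (partialDualValue k μ ψ) ≤ partialCost k μ := by
  refine le_iInf₂ fun P hP => ?_
  have hP : ∀ i : Fin k, P.map (fun x => x i) = μ := hP
  by_cases htop : ∫⁻ x, coulomb k x ∂P = ∞
  · simp [htop]
  have hmass : P Set.univ = μ Set.univ := by
    rw [← hP ⟨0, hk⟩, Measure.map_apply (measurable_pi_apply _) MeasurableSet.univ, Set.preimage_univ]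
  have : IsFiniteMeasure P := ⟨by rw [hmass]; exact measure_lt_top _ _⟩
  have hint : ∀ i : Fin k, Integrable (fun x => ψ (x i)) P := fun i => by
    have := integrable_zeroAtInfty μ ψ
    rw [← hP i] at this
    exact this.comp_measurable (measurable_pi_apply i)
  have hval : ∀ i : Fin k, ∫ x, ψ (x i) ∂P = ∫ x, ψ x ∂μ := fun i => by
    rw [← hP i, integral_map (measurable_pi_apply i).aemeasurable
      ψ.continuous.aestronglyMeasurable]
  have hk0 : (k : ℝ) ≠ 0 := by positivity
  have hsum : ∫ x, (1 / (k : ℝ)) * ∑ i, ψ (x i) ∂P = ∫ x, ψ x ∂μ := by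
    rw [integral_const_mul, integral_finsetSum _ fun i _ => hint i]
    simp only [hval, Finset.sum_const, Finset.card_univ, Fintype.card_fin, nsmul_eq_mul]
    field_simp
  have hI1 : Integrable (fun x : Fin k → E d => (1 / (k : ℝ)) * ∑ i, ψ (x i)) P :=
    (integrable_finsetSum _ fun i _ => hint i).const_mul _
  have hI2 : Integrable (fun x => (coulomb k x).toReal) P :=
    integrable_toReal_of_lintegral_ne_top (measurable_coulomb k).aemeasurable htop
  have hfin : ∀ᵐ x ∂P, coulomb k x < ∞ := ae_lt_top (measurable_coulomb k) htop
  have hle : ∫ x, ((1 / (k : ℝ)) * ∑ i, ψ (x i) - (coulomb k x).toReal) ∂P ≤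
      ∫ _x, M k ψ ∂P := by
    refine integral_mono_ae (hI1.sub hI2) (integrable_const _) ?_
    filter_upwards [hfin] with x hx
    exact le_M ψ hx.ne
  rw [integral_sub hI1 hI2, hsum, integral_toReal (measurable_coulomb k).aemeasurable hfin,
    integral_const, smul_eq_mul, measureReal_def, hmass] at hle
  refine ENNReal.ofReal_le_of_le_toReal ?_
  rw [partialDualValue, measureReal_def]
  linarith

theorem partialCost_smul_le (k : ℕ) (μ : Measure (E d)) {a : ℝ≥0∞} (h0 : a ≠ 0) (ha : a ≠ ∞) :
    partialCost k (a • μ) ≤ a * partialCost k μ := by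
  rw [partialCost, partialCost, ENNReal.mul_iInf_of_ne h0 ha]
  refine le_iInf fun P => ?_
  rw [ENNReal.mul_iInf_of_ne h0 ha]
  refine le_iInf fun hP => (iInf₂_le (a • P) fun i => ?_).trans ?_
  · rw [Measure.map_smul, hP i]
  · simp

theorem partialCost_zero (k : ℕ) : partialCost k (0 : Measure (E d)) = 0 :=
  le_antisymm ((iInf₂_le (0 : Measure (Fin k → E d)) (by simp)).trans (by simp)) bot_le

/-- Under a plan, the first two points both lie in a ball except on a set of mass at most twice the
mass of `μ` outside it. Two points in a ball interact by at least the inverse of its diameter, so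
zero cost forces `‖μ‖ ≤ 2 μ(Bᶜ)` for every ball `B`, and the right side tends to zero. -/
theorem eq_zero_of_partialCost_eq_zero {k : ℕ} (hk : 2 ≤ k) (μ : Measure (E d))
    [IsFiniteMeasure μ] (h : partialCost k μ = 0) : μ = 0 := by
  have key : ∀ n : ℕ, μ Set.univ ≤ 2 * μ (Metric.closedBall 0 (n : ℝ))ᶜ := by
    intro n
    set B : Set (E d) := Metric.closedBall 0 (n : ℝ)
    have hB : MeasurableSet B := Metric.isClosed_closedBall.measurableSet
    -- The diameter bound is `2n`; the extra `1` keeps `R` nonzero when `n = 0`.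
    set R : ℝ≥0∞ := ENNReal.ofReal (2 * n + 1)
    have hR0 : R ≠ 0 := by simp only [R, ne_eq, ENNReal.ofReal_eq_zero, not_le]; positivity
    have hle : (μ Set.univ - 2 * μ Bᶜ) / R ≤ partialCost k μ := by
      refine le_iInf₂ fun P hP => ?_
      have hP : ∀ i : Fin k, P.map (fun x => x i) = μ := hP
      let i0 : Fin k := ⟨0, by omega⟩
      let i1 : Fin k := ⟨1, by omega⟩
      have hi : i0 < i1 := by simp [i0, i1]
      set A : Set (Fin k → E d) := {x | x i0 ∈ B ∧ x i1 ∈ B}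
      have hA : MeasurableSet A :=
        (measurable_pi_apply (X := fun _ => E d) i0 hB).inter
          (measurable_pi_apply (X := fun _ => E d) i1 hB)
      have hm : ∀ i (s : Set (E d)), MeasurableSet s → P {x | x i ∈ s} = μ s := fun i s hs => by
        rw [← hP i, Measure.map_apply (measurable_pi_apply i) hs]; rfl
      have h1 : μ Set.univ ≤ P A + 2 * μ Bᶜ := by
        rw [← hm i0 _ MeasurableSet.univ, two_mul]
        nth_rw 2 [← hm i0 _ hB.compl]
        rw [← hm i1 _ hB.compl]
        refine (measure_mono ?_).trans ((measure_union_le _ _).trans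
          (add_le_add le_rfl (measure_union_le _ _)))
        intro x _
        by_cases h0 : x i0 ∈ B <;> by_cases h1 : x i1 ∈ B <;> simp [A, h0, h1]
      have h2 : R⁻¹ * P A ≤ ∫⁻ x, coulomb k x ∂P := by
        refine le_trans ?_ (setLIntegral_le_lintegral A _)
        rw [← setLIntegral_const]
        refine setLIntegral_mono (measurable_coulomb k) fun x hx => ?_
        have hd : edist (x i0) (x i1) ≤ R := by
          rw [edist_dist]
          refine ENNReal.ofReal_le_ofReal ?_
          have h3 := dist_triangle_right (x i0) (x i1) 0
          have h4 := Metric.mem_closedBall.1 hx.1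
          have h5 := Metric.mem_closedBall.1 hx.2
          linarith
        refine (ENNReal.inv_le_inv.2 hd).trans ?_
        refine le_trans ?_ (Finset.single_le_sum (f := fun i => ∑ j ∈ Finset.Ioi i,
          (edist (x i) (x j))⁻¹) (fun _ _ => bot_le) (Finset.mem_univ i0))
        exact Finset.single_le_sum (f := fun j => (edist (x i0) (x j))⁻¹) (fun _ _ => bot_le)
          (Finset.mem_Ioi.2 hi)
      rw [ENNReal.div_eq_inv_mul]
      refine le_trans (mul_le_mul_right (tsub_le_iff_right.2 h1) _) h2
    rw [h, nonpos_iff_eq_zero, ENNReal.div_eq_zero_iff] at hle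
    rcases hle with h' | h'
    · exact tsub_eq_zero_iff_le.1 h'
    · exact absurd h' ENNReal.ofReal_ne_top
  have hlim : Tendsto (fun n : ℕ => 2 * μ (Metric.closedBall (0 : E d) (n : ℝ))ᶜ) atTop
      (𝓝 (2 * 0)) := by
    refine ENNReal.Tendsto.const_mul ?_ (Or.inr (by simp))
    have := tendsto_measure_iInter_atTop (μ := μ)
      (s := fun n : ℕ => (Metric.closedBall (0 : E d) (n : ℝ))ᶜ)
      (fun n => Metric.isClosed_closedBall.measurableSet.compl.nullMeasurableSet)
      (fun m n hmn => Set.compl_subset_compl.2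
        (Metric.closedBall_subset_closedBall (by exact_mod_cast hmn)))
      ⟨0, measure_ne_top _ _⟩
    rwa [← Set.compl_iUnion, Metric.iUnion_closedBall_nat, Set.compl_univ, measure_empty] at this
  rw [mul_zero] at hlim
  exact Measure.measure_univ_eq_zero.1 (le_antisymm (ge_of_tendsto' hlim key) bot_le)

/-! ### Symmetrization and stratification of plans -/

/-- A plan with arbitrary marginals can be symmetrized by cyclic shifts of the variables. -/
theorem partialCost_average_le {k : ℕ} (hk : 1 ≤ k) (Q : Measure (Fin k → E d)) :
    partialCost k ((k : ℝ≥0∞)⁻¹ • ∑ j, Q.map (fun x => x j)) ≤ ∫⁻ x, coulomb k x ∂Q := by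
  have : NeZero k := ⟨by omega⟩
  have hk0 : (k : ℝ≥0∞) ≠ 0 := by exact_mod_cast (NeZero.ne k)
  have hm : ∀ s : Fin k, Measurable fun (x : Fin k → E d) (j : Fin k) => x (s + j) := fun s =>
    measurable_pi_lambda _ fun j => measurable_pi_apply _
  refine (iInf₂_le ((k : ℝ≥0∞)⁻¹ • ∑ s, Q.map (fun x j => x (s + j))) fun i => ?_).trans ?_
  · ext B hB
    have h1 : ∀ s : Fin k, (Q.map (fun x j => x (s + j))) ((fun x => x i) ⁻¹' B) =
        Q.map (fun x => x (s + i)) B := fun s => by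
      rw [Measure.map_apply (hm s) (measurable_pi_apply i hB),
        Measure.map_apply (measurable_pi_apply (s + i)) hB]
      rfl
    rw [Measure.map_apply (measurable_pi_apply i) hB]
    simp only [Measure.smul_apply, Measure.finsetSum_apply, h1]
    congr 1
    -- Addition in `Fin k` is cyclic, so as the shift `s` varies, `s + i` runs over all indices and
    -- every marginal becomes the average.
    exact Equiv.sum_comp (Equiv.addRight i) fun j => Q.map (fun x => x j) B
  · rw [lintegral_smul_measure, lintegral_finsetSum_measure, smul_eq_mul]
    have h2 : ∀ s : Fin k, ∫⁻ x, coulomb k x ∂(Q.map (fun x j => x (s + j))) ≤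
        ∫⁻ x, coulomb k x ∂Q := fun s => by
      rw [lintegral_map (measurable_coulomb k) (hm s)]
      exact lintegral_mono fun x => coulomb_comp_le x _ (add_right_injective s)
    refine (mul_le_mul_right (Finset.sum_le_sum fun s _ => h2 s) _).trans ?_
    rw [Finset.sum_const, Finset.card_univ, Fintype.card_fin, nsmul_eq_mul, ← mul_assoc,
      ENNReal.inv_mul_cancel hk0 (ENNReal.natCast_ne_top k), one_mul]

/-- Regroups the set of present points by its cardinality. The empty set is left out, which is why a
decomposition may have total mass below one. -/
theorem sum_Icc_sum_card_eq {N : ℕ} (f : Finset (Fin N) → ℝ≥0∞) :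
    ∑ k ∈ Finset.Icc 1 N, ∑ S : {S : Finset (Fin N) // S.card = k}, f S =
      ∑ S with S.Nonempty, f S := by
  rw [← Finset.sum_fiberwise_of_maps_to (t := Finset.Icc 1 N) (g := Finset.card)]
  · refine Finset.sum_congr rfl fun k hk => ?_
    refine (Finset.sum_subtype _ (fun S => ?_) f).symm
    have := (Finset.mem_Icc.1 hk).1
    simp only [Finset.mem_filter, Finset.mem_univ, true_and, and_iff_right_iff_imp]
    intro h
    exact Finset.card_pos.1 (by omega)
  · intro S hS
    simp only [Finset.mem_filter, Finset.mem_univ, true_and] at hS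
    exact Finset.mem_Icc.2 ⟨Finset.card_pos.2 hS, by simpa using Finset.card_le_univ S⟩

/-- A random family of `N` points of `ℝ^d`, the `i`-th of which is only present on the event `F i`,
gives rise to an admissible decomposition, according to the number of points present. -/
theorem exists_decomposition {Ω : Type*} [MeasurableSpace Ω] (P : Measure Ω)
    (hP : P Set.univ ≤ 1) {N : ℕ} (y : Fin N → Ω → E d) (hy : ∀ i, Measurable (y i))
    (F : Fin N → Set Ω) (hF : ∀ i, MeasurableSet (F i)) :
    ∃ r : ℕ → Measure (E d),
      IsDecomposition N ((N : ℝ≥0∞)⁻¹ • ∑ i, (P.restrict (F i)).map (y i)) r ∧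
      stratifiedCost N r ≤ ∫⁻ ω, ∑ i, ∑ j ∈ Finset.Ioi i,
        (F i ∩ F j).indicator (fun ω => (edist (y i ω) (y j ω))⁻¹) ω ∂P := by
  classical
  set c : Ω → ℝ≥0∞ := fun ω => ∑ i, ∑ j ∈ Finset.Ioi i,
    (F i ∩ F j).indicator (fun ω => (edist (y i ω) (y j ω))⁻¹) ω
  -- On `U S` exactly the points with index in `S` are present; these events partition `Ω`.
  let U : Finset (Fin N) → Set Ω := fun S => {ω | ∀ i, ω ∈ F i ↔ i ∈ S}
  have hU : ∀ S, MeasurableSet (U S) := fun S => by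
    have : U S = ⋂ i, {ω | ω ∈ F i ↔ i ∈ S} := by ext; simp [U]
    rw [this]
    refine MeasurableSet.iInter fun i => ?_
    by_cases hi : i ∈ S
    · simpa [hi] using hF i
    · have h : {ω | ω ∈ F i ↔ i ∈ S} = (F i)ᶜ := by ext; simp [hi]
      rw [h]
      exact (hF i).compl
  have hdisj : Pairwise (Function.onFun Disjoint U) := by
    intro S T hST
    refine Set.disjoint_left.2 fun ω hS hT => hST ?_
    ext i
    rw [← hS i, hT i]
  have hcover : ⋃ S, U S = Set.univ := by
    refine Set.eq_univ_of_forall fun ω => Set.mem_iUnion.2 ⟨Finset.univ.filter (ω ∈ F ·), ?_⟩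
    simp [U]
  have hpart : ∑ S, P.restrict (U S) = P := by
    rw [← Measure.sum_fintype, ← Measure.restrict_iUnion hdisj hU, hcover, Measure.restrict_univ]
  let T : ∀ k : ℕ, {S : Finset (Fin N) // S.card = k} → Ω → Fin k → E d :=
    fun k S ω j => y (S.1.orderEmbOfFin S.2 j) ω
  have hT : ∀ k S, Measurable (T k S) := fun k S => measurable_pi_lambda _ fun j => hy _
  let Q : ∀ k : ℕ, Measure (Fin k → E d) := fun k => ∑ S, (P.restrict (U S.1)).map (T k S)
  -- The average of the marginals of `Q k`, whose mass is the measure of the event that exactly `k`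
  -- points are present. The weight `k/N` cancels the factor `1/k`, so each present point is counted
  -- with weight `1/N`.
  let r : ℕ → Measure (E d) := fun k => (k : ℝ≥0∞)⁻¹ • ∑ j, (Q k).map (fun x => x j)
  have hk0 : ∀ {k}, k ∈ Finset.Icc 1 N → (k : ℝ≥0∞) ≠ 0 := fun {k} hk => by
    have := (Finset.mem_Icc.1 hk).1
    exact_mod_cast (by omega : k ≠ 0)
  have hmarg : ∀ (k : ℕ) (B : Set (E d)), MeasurableSet B → ∑ j, (Q k).map (fun x => x j) B =
      ∑ S : {S : Finset (Fin N) // S.card = k}, ∑ i ∈ S.1, P (y i ⁻¹' B ∩ U S) := by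
    intro k B hB
    have h1 : ∀ j, (Q k).map (fun x => x j) B = ∑ S : {S : Finset (Fin N) // S.card = k},
        P (y (S.1.orderEmbOfFin S.2 j) ⁻¹' B ∩ U S) := by
      intro j
      rw [Measure.map_apply (measurable_pi_apply j) hB]
      simp only [Q, Measure.finsetSum_apply]
      refine Finset.sum_congr rfl fun S _ => ?_
      rw [Measure.map_apply (hT k S) (measurable_pi_apply j hB), Measure.restrict_apply]
      · rfl
      · exact hT k S (measurable_pi_apply j hB)
    simp only [h1]
    rw [Finset.sum_comm]
    refine Finset.sum_congr rfl fun S _ => ?_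
    have h2 : Finset.univ.image (S.1.orderEmbOfFin S.2) = S.1 := Finset.image_orderEmbOfFin_univ _ _
    rw [← Finset.sum_image (s := Finset.univ) (g := S.1.orderEmbOfFin S.2)
      (f := fun i => P (y i ⁻¹' B ∩ U S)) (S.1.orderEmbOfFin S.2).injective.injOn, h2]
  have hmass : ∀ k ∈ Finset.Icc 1 N, r k Set.univ =
      ∑ S : {S : Finset (Fin N) // S.card = k}, P (U S) := by
    intro k hk
    simp only [r, Measure.smul_apply, Measure.finsetSum_apply, hmarg k _ MeasurableSet.univ,
      Set.preimage_univ, Set.univ_inter, Finset.sum_const, smul_eq_mul]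
    have : ∀ S : {S : Finset (Fin N) // S.card = k}, S.1.card • P (U S) = k * P (U S) := fun S => by
      rw [S.2, nsmul_eq_mul]
    simp only [this]
    rw [← Finset.mul_sum, ← mul_assoc,
      ENNReal.inv_mul_cancel (hk0 hk) (ENNReal.natCast_ne_top k), one_mul]
  refine ⟨r, ⟨?_, ?_⟩, ?_⟩
  · ext B hB
    have h1 : ∀ k ∈ Finset.Icc 1 N, (((k : ℝ≥0∞) / N) • r k) B = (N : ℝ≥0∞)⁻¹ *
        ∑ S : {S : Finset (Fin N) // S.card = k}, ∑ i ∈ S.1, P (y i ⁻¹' B ∩ U S) := by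
      intro k hk
      simp only [r, Measure.smul_apply, Measure.finsetSum_apply, hmarg k B hB, smul_eq_mul]
      rw [ENNReal.div_eq_inv_mul, mul_assoc, ← mul_assoc (k : ℝ≥0∞),
        ENNReal.mul_inv_cancel (hk0 hk) (ENNReal.natCast_ne_top k), one_mul]
    rw [Measure.finsetSum_apply, Finset.sum_congr rfl h1, ← Finset.mul_sum,
      sum_Icc_sum_card_eq fun S => ∑ i ∈ S, P (y i ⁻¹' B ∩ U S), Measure.smul_apply, smul_eq_mul,
      Measure.finsetSum_apply]
    congr 1
    -- The empty set can be put back into the sum: it carries no point.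
    rw [Finset.sum_filter_of_ne]
    · have h2 : ∀ i, (P.restrict (F i)).map (y i) B =
          ∑ S, if i ∈ S then P (y i ⁻¹' B ∩ U S) else 0 := by
        intro i
        rw [Measure.map_apply (hy i) hB, Measure.restrict_apply (hy i hB)]
        nth_rw 1 [← hpart]
        rw [Measure.finsetSum_apply]
        refine Finset.sum_congr rfl fun S _ => ?_
        rw [Measure.restrict_apply ((hy i hB).inter (hF i))]
        split_ifs with hi
        · congr 1
          ext ω
          simp only [Set.mem_inter_iff, U, Set.mem_ofPred_eq]
          exact ⟨fun h => ⟨h.1.1, h.2⟩, fun h => ⟨⟨h.1, (h.2 i).2 hi⟩, h.2⟩⟩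
        · convert measure_empty (μ := P)
          ext ω
          simp only [Set.mem_inter_iff, U, Set.mem_ofPred_eq, Set.mem_empty_iff_false, iff_false]
          exact fun h => hi ((h.2 i).1 h.1.2)
      simp only [h2]
      rw [Finset.sum_comm]
      refine Finset.sum_congr rfl fun S _ => ?_
      simp
    · intro S _ hS
      by_contra h
      rw [Finset.not_nonempty_iff_eq_empty] at h
      simp [h] at hS
  · rw [Finset.sum_congr rfl hmass, sum_Icc_sum_card_eq fun S => P (U S)]
    refine (Finset.sum_le_sum_of_subset (Finset.filter_subset _ _)).trans (le_trans ?_ hP)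
    nth_rw 2 [← hpart]
    simp
  · have h1 : ∀ k ∈ Finset.Icc 1 N, partialCost k (r k) ≤
        ∑ S : {S : Finset (Fin N) // S.card = k}, ∫⁻ ω in U S, c ω ∂P := by
      intro k hk
      refine (partialCost_average_le (Finset.mem_Icc.1 hk).1 (Q k)).trans ?_
      simp only [Q]
      rw [lintegral_finsetSum_measure]
      refine Finset.sum_le_sum fun S _ => ?_
      rw [lintegral_map (measurable_coulomb k) (hT k S)]
      refine setLIntegral_mono' (hU S) fun ω hω => ?_
      refine le_trans (le_of_eq ?_) (sum_Ioi_comp_le (fun i j => (F i ∩ F j).indicator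
        (fun ω => (edist (y i ω) (y j ω))⁻¹) ω) (fun i j => ?_) (S.1.orderEmbOfFin S.2)
        (S.1.orderEmbOfFin S.2).injective)
      · refine Finset.sum_congr rfl fun a _ => Finset.sum_congr rfl fun b _ => ?_
        rw [Set.indicator_of_mem]
        exact ⟨(hω _).2 (S.1.orderEmbOfFin_mem S.2 a), (hω _).2 (S.1.orderEmbOfFin_mem S.2 b)⟩
      · simp only [edist_comm (y i _), Set.inter_comm (F i)]
    refine (Finset.sum_le_sum h1).trans ?_
    rw [sum_Icc_sum_card_eq fun S => ∫⁻ ω in U S, c ω ∂P]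
    refine (Finset.sum_le_sum_of_subset (Finset.filter_subset _ _)).trans ?_
    rw [← lintegral_finsetSum_measure, hpart]

section Compactification

open scoped OnePoint CompactlySupported

/-! ### An abstract duality principle on compact spaces -/

/-- The cone of the pairs `(h, t)` with `t ≥ 0` and `h + t c ≥ 0`. -/
def costCone {K : Type*} [TopologicalSpace K] (c : K → ℝ≥0∞) : PointedCone ℝ (C(K, ℝ) × ℝ) where
  carrier := {p | 0 ≤ p.2 ∧ ∀ x, ENNReal.ofReal (-p.1 x) ≤ ENNReal.ofReal p.2 * c x}
  zero_mem' := by simp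
  add_mem' := by
    rintro ⟨h, t⟩ ⟨h', t'⟩ ⟨ht, hh⟩ ⟨ht', hh'⟩
    refine ⟨add_nonneg ht ht', fun x => ?_⟩
    simp only [Prod.mk_add_mk, ContinuousMap.add_apply, neg_add]
    rw [ENNReal.ofReal_add ht ht', add_mul]
    exact ENNReal.ofReal_add_le.trans (add_le_add (hh x) (hh' x))
  smul_mem' := by
    rintro ⟨a, ha⟩ ⟨h, t⟩ ⟨ht, hh⟩
    refine ⟨mul_nonneg ha ht, fun x => ?_⟩
    have h1 : -(a * h x) = a * -h x := by ring
    change ENNReal.ofReal (-(a * h x)) ≤ ENNReal.ofReal (a * t) * c x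
    rw [h1, ENNReal.ofReal_mul ha, ENNReal.ofReal_mul ha, mul_assoc]
    exact mul_le_mul_right (hh x) _

/-- The hypothesis says that `(h, t) ↦ F h + tD`, defined on `V × ℝ`, is nonnegative on `costCone
c`. An extension `G` nonnegative on the whole cone is a positive functional on the slice `t = 0`,
hence a measure; the pairs `(-h, 1)` with `h ≤ c` lie in the cone and give the cost bound. -/
theorem exists_measure_of_dual_bound {K : Type*} [TopologicalSpace K] [CompactSpace K] [T2Space K]
    [MeasurableSpace K] [BorelSpace K] (c : K → ℝ≥0∞) (V : Submodule ℝ C(K, ℝ))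
    (hV : (1 : C(K, ℝ)) ∈ V) (F : C(K, ℝ) →ₗ[ℝ] ℝ) (D : ℝ)
    (hF : ∀ h ∈ V, ∀ t : ℝ, 0 ≤ t → (∀ x, ENNReal.ofReal (-h x) ≤ ENNReal.ofReal t * c x) →
      0 ≤ F h + t * D) :
    ∃ P : Measure K, IsFiniteMeasure P ∧ (∀ h ∈ V, ∫ x, h x ∂P = F h) ∧
      ∀ h : C(K, ℝ), (∀ x, ENNReal.ofReal (h x) ≤ c x) → ∫ x, h x ∂P ≤ D := by
  let f : (C(K, ℝ) × ℝ) →ₗ.[ℝ] ℝ :=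
    ⟨V.prod ⊤, (F.comp (LinearMap.fst ℝ _ _) + D • LinearMap.snd ℝ _ _).domRestrict _⟩
  have hf : ∀ x : f.domain, f x = F (x : C(K, ℝ) × ℝ).1 + D * (x : C(K, ℝ) × ℝ).2 := fun x => rfl
  obtain ⟨G, hG, hGs⟩ := riesz_extension (costCone c) f
    (fun x hx => by
      rw [hf, mul_comm]
      exact hF _ x.2.1 _ hx.1 hx.2)
    -- The domain must absorb every `y` into the cone: the constant `‖y.1‖`, available since `1 ∈
    -- V`, and `|y.2|` suffice.
    (fun y => by
      refine ⟨⟨(‖y.1‖ • 1, |y.2|), V.smul_mem _ hV, trivial⟩, ?_, fun x => ?_⟩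
      · change 0 ≤ |y.2| + y.2
        linarith [neg_abs_le y.2]
      · have h1 : |y.1 x| ≤ ‖y.1‖ := y.1.norm_coe_le_norm x
        rw [ENNReal.ofReal_of_nonpos]
        · exact bot_le
        · change -(‖y.1‖ * 1 + y.1 x) ≤ 0
          linarith [neg_abs_le (y.1 x)])
  let Λ : C_c(K, ℝ) →ₚ[ℝ] ℝ := PositiveLinearMap.mk₀
    { toFun := fun g => G (g.toContinuousMap, 0)
      map_add' := fun g g' => by
        rw [← map_add]
        congr 1
        ext <;> simp
      map_smul' := fun a g => by
        rw [RingHom.id_apply, ← map_smul]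
        congr 1
        ext <;> simp }
    (fun g hg => hGs _ ⟨le_rfl, fun x => by
      have : 0 ≤ g x := hg x
      rw [ENNReal.ofReal_of_nonpos]
      · exact bot_le
      · change -g x ≤ 0
        linarith⟩)
  have hΛ : ∀ h : C(K, ℝ), ∫ x, h x ∂(RealRMK.rieszMeasure Λ) = G (h, 0) := fun h =>
    RealRMK.integral_rieszMeasure Λ (CompactlySupportedContinuousMap.continuousMapEquiv h)
  refine ⟨RealRMK.rieszMeasure Λ, inferInstance, fun h hh => ?_, fun h hh => ?_⟩
  · rw [hΛ]
    have := hG ⟨(h, 0), hh, trivial⟩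
    rw [hf] at this
    simpa using this
  · rw [hΛ]
    have h1 : 0 ≤ G (-h, 1) := hGs _ ⟨zero_le_one, fun x => by simpa using hh x⟩
    have h2 : G (0, 1) = D := by
      have := hG ⟨(0, 1), V.zero_mem, trivial⟩
      rw [hf] at this
      simpa using this
    have h3 : ((-h, 1) : C(K, ℝ) × ℝ) = (0, 1) - (h, 0) := by ext <;> simp
    rw [h3, map_sub, h2] at h1
    linarith

/-! ### The Coulomb cost on the one-point compactification -/

/-- The extension of a function of two variables by zero at infinity. -/
def extendPair {β : Type*} [Zero β] (g : E d → E d → β) (x y : OnePoint (E d)) : β :=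
  x.elim 0 fun a => y.elim 0 (g a)

/-- Near a pair with an infinite coordinate the extension vanishes identically; near a finite pair
it is `g` seen through an open embedding. -/
theorem continuous_extendPair {g : E d → E d → ℝ} (hg : Continuous fun p : E d × E d => g p.1 p.2)
    {R : ℝ} (h1 : ∀ a b, R < ‖a‖ → g a b = 0) (h2 : ∀ a b, R < ‖b‖ → g a b = 0) :
    Continuous fun p : OnePoint (E d) × OnePoint (E d) => extendPair g p.1 p.2 := by
  set V : Set (OnePoint (E d)) := ((↑) '' Metric.closedBall (0 : E d) R)ᶜ
  have hV : V ∈ 𝓝 (∞ : OnePoint (E d)) :=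
    (OnePoint.isOpen_compl_image_coe.2
      ⟨Metric.isClosed_closedBall, isCompact_closedBall _ _⟩).mem_nhds (by simp)
  have hmem : ∀ a : E d, (a : OnePoint (E d)) ∈ V → R < ‖a‖ := fun a ha => by
    by_contra h
    exact ha ⟨a, by simpa using h, rfl⟩
  refine continuous_iff_continuousAt.2 ?_
  rintro ⟨x, y⟩
  induction x using OnePoint.rec with
  | infty =>
    refine (continuousAt_const (y := (0 : ℝ))).congr ?_
    filter_upwards [prod_mem_nhds hV univ_mem] with ⟨x, y⟩ hxy
    induction x using OnePoint.rec with
    | infty => rfl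
    | coe a =>
      induction y using OnePoint.rec with
      | infty => rfl
      | coe b => exact (h1 a b (hmem a hxy.1)).symm
  | coe a =>
    induction y using OnePoint.rec with
    | infty =>
      refine (continuousAt_const (y := (0 : ℝ))).congr ?_
      filter_upwards [prod_mem_nhds univ_mem hV] with ⟨x, y⟩ hxy
      induction x using OnePoint.rec with
      | infty => rfl
      | coe a =>
        induction y using OnePoint.rec with
        | infty => rfl
        | coe b => exact (h2 a b (hmem b hxy.2)).symm
    | coe b =>
      have hemb := (OnePoint.isOpenEmbedding_coe (X := E d)).prodMap
        (OnePoint.isOpenEmbedding_coe (X := E d))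
      exact (hemb.continuousAt_iff (x := (a, b))).1 hg.continuousAt

/-- A cutoff function, supported in the ball of radius `n + 1`. -/
def cutoff (n : ℕ) (a : E d) : ℝ := max 0 (1 - ‖a‖ / (n + 1))

theorem cutoff_eq_zero {n : ℕ} {a : E d} (h : (n : ℝ) + 1 < ‖a‖) : cutoff n a = 0 := by
  refine max_eq_left (sub_nonpos.2 ?_)
  rw [le_div_iff₀ (by positivity)]
  linarith

theorem cutoff_nonneg (n : ℕ) (a : E d) : 0 ≤ cutoff n a := le_max_left _ _

theorem cutoff_le_one (n : ℕ) (a : E d) : cutoff n a ≤ 1 :=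
  max_le zero_le_one (sub_le_self _ (by positivity))

theorem continuous_cutoff (n : ℕ) : Continuous (cutoff (d := d) n) := by
  unfold cutoff
  fun_prop

theorem tendsto_cutoff (a : E d) : Tendsto (fun n => cutoff n a) atTop (𝓝 1) := by
  have h : Tendsto (fun n : ℕ => ‖a‖ * (1 / ((n : ℝ) + 1))) atTop (𝓝 (‖a‖ * 0)) :=
    tendsto_one_div_add_atTop_nhds_zero_nat.const_mul _
  have h2 := (tendsto_const_nhds (x := (0 : ℝ))).max ((tendsto_const_nhds (x := (1 : ℝ))).sub h)
  simpa [cutoff, div_eq_mul_inv] using h2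

/-- Continuous compactly supported approximation of the pair cost `1 / |a - b|`. -/
def truncCost (n : ℕ) (a b : E d) : ℝ := cutoff n a * cutoff n b / (dist a b + 1 / ((n : ℝ) + 1))

theorem truncCost_nonneg (n : ℕ) (a b : E d) : 0 ≤ truncCost n a b :=
  div_nonneg (mul_nonneg (cutoff_nonneg n a) (cutoff_nonneg n b)) (by positivity)

theorem continuous_truncCost (n : ℕ) :
    Continuous fun p : E d × E d => truncCost n p.1 p.2 := by
  unfold truncCost
  refine Continuous.div ?_ ?_ fun p => ?_
  · exact ((continuous_cutoff n).comp continuous_fst).mul ((continuous_cutoff n).comp continuous_snd)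
  · fun_prop
  · positivity

theorem ofReal_truncCost (n : ℕ) (a b : E d) : ENNReal.ofReal (truncCost n a b) =
    ENNReal.ofReal (cutoff n a * cutoff n b) *
      (edist a b + ENNReal.ofReal (1 / ((n : ℝ) + 1)))⁻¹ := by
  rw [truncCost, ENNReal.ofReal_div_of_pos (by positivity), ENNReal.ofReal_add dist_nonneg
    (by positivity), edist_dist, ENNReal.div_eq_inv_mul, mul_comm]

theorem ofReal_truncCost_le (n : ℕ) (a b : E d) :
    ENNReal.ofReal (truncCost n a b) ≤ (edist a b)⁻¹ := by
  rw [ofReal_truncCost]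
  refine (mul_le_mul' (ENNReal.ofReal_le_one.2 ?_) (ENNReal.inv_le_inv.2 le_self_add)).trans
    (one_mul _).le
  exact mul_le_one₀ (cutoff_le_one n a) (cutoff_nonneg n b) (cutoff_le_one n b)

theorem tendsto_truncCost (a b : E d) :
    Tendsto (fun n => ENNReal.ofReal (truncCost n a b)) atTop (𝓝 (edist a b)⁻¹) := by
  simp only [ofReal_truncCost]
  have h1 : Tendsto (fun n => ENNReal.ofReal (cutoff n a * cutoff n b)) atTop (𝓝 1) := by
    have := ENNReal.tendsto_ofReal ((tendsto_cutoff a).mul (tendsto_cutoff b))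
    simpa using this
  have h2 : Tendsto (fun n : ℕ => (edist a b + ENNReal.ofReal (1 / ((n : ℝ) + 1)))⁻¹) atTop
      (𝓝 (edist a b)⁻¹) := by
    refine tendsto_inv_iff.2 ?_
    have := (tendsto_const_nhds (x := edist a b)).add
      (ENNReal.tendsto_ofReal tendsto_one_div_add_atTop_nhds_zero_nat)
    simpa using this
  have h3 := ENNReal.Tendsto.mul h1 (Or.inl one_ne_zero) h2 (Or.inr ENNReal.one_ne_top)
  rwa [one_mul] at h3

theorem ofReal_extendPair_truncCost_le (n : ℕ) (x y : OnePoint (E d)) :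
    ENNReal.ofReal (extendPair (truncCost n) x y) ≤
      extendPair (fun a b : E d => (edist a b)⁻¹) x y := by
  induction x using OnePoint.rec with
  | infty => simp [extendPair]
  | coe a =>
    induction y using OnePoint.rec with
    | infty => simp [extendPair]
    | coe b => exact ofReal_truncCost_le n a b

theorem tendsto_extendPair_truncCost (x y : OnePoint (E d)) :
    Tendsto (fun n => ENNReal.ofReal (extendPair (truncCost n) x y)) atTop
      (𝓝 (extendPair (fun a b : E d => (edist a b)⁻¹) x y)) := by
  induction x using OnePoint.rec with
  | infty => simp [extendPair]
  | coe a =>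
    induction y using OnePoint.rec with
    | infty => simp [extendPair]
    | coe b => exact tendsto_truncCost a b

theorem extendPair_truncCost_nonneg (n : ℕ) (x y : OnePoint (E d)) :
    0 ≤ extendPair (truncCost n) x y := by
  induction x using OnePoint.rec with
  | infty => exact le_rfl
  | coe a =>
    induction y using OnePoint.rec with
    | infty => exact le_rfl
    | coe b => exact truncCost_nonneg n a b

/-- The Coulomb cost on the compactified configuration space, in which the points at infinity do
not interact. -/
def compactCoulomb {N : ℕ} (ω : Fin N → OnePoint (E d)) : ℝ≥0∞ :=
  ∑ i, ∑ j ∈ Finset.Ioi i, extendPair (fun a b : E d => (edist a b)⁻¹) (ω i) (ω j)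

/-- Continuous approximations of `compactCoulomb`. -/
def truncCoulomb (N n : ℕ) : C(Fin N → OnePoint (E d), ℝ) where
  toFun ω := ∑ i, ∑ j ∈ Finset.Ioi i, extendPair (truncCost n) (ω i) (ω j)
  continuous_toFun := by
    refine continuous_finsetSum _ fun i _ => continuous_finsetSum _ fun j _ => ?_
    have := continuous_extendPair (continuous_truncCost (d := d) n) (R := n + 1)
      (fun a b h => by simp [truncCost, cutoff_eq_zero h])
      (fun a b h => by simp [truncCost, cutoff_eq_zero h])
    have hij : Continuous fun ω : Fin N → OnePoint (E d) => (ω i, ω j) :=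
      (continuous_apply i).prodMk (continuous_apply j)
    exact this.comp hij

theorem ofReal_truncCoulomb (N n : ℕ) (ω : Fin N → OnePoint (E d)) :
    ENNReal.ofReal (truncCoulomb N n ω) =
      ∑ i, ∑ j ∈ Finset.Ioi i, ENNReal.ofReal (extendPair (truncCost n) (ω i) (ω j)) := by
  change ENNReal.ofReal (∑ i, ∑ j ∈ Finset.Ioi i, extendPair (truncCost n) (ω i) (ω j)) = _
  rw [ENNReal.ofReal_sum_of_nonneg fun i _ => Finset.sum_nonneg fun j _ =>
    extendPair_truncCost_nonneg n _ _]
  refine Finset.sum_congr rfl fun i _ => ?_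
  rw [ENNReal.ofReal_sum_of_nonneg fun j _ => extendPair_truncCost_nonneg n _ _]

theorem ofReal_truncCoulomb_le (N n : ℕ) (ω : Fin N → OnePoint (E d)) :
    ENNReal.ofReal (truncCoulomb N n ω) ≤ compactCoulomb ω := by
  rw [ofReal_truncCoulomb]
  exact Finset.sum_le_sum fun i _ => Finset.sum_le_sum fun j _ =>
    ofReal_extendPair_truncCost_le n _ _

theorem tendsto_truncCoulomb (N : ℕ) (ω : Fin N → OnePoint (E d)) :
    Tendsto (fun n => ENNReal.ofReal (truncCoulomb N n ω)) atTop (𝓝 (compactCoulomb ω)) := by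
  simp only [ofReal_truncCoulomb]
  exact tendsto_finsetSum _ fun i _ => tendsto_finsetSum _ fun j _ =>
    tendsto_extendPair_truncCost _ _

/-- The extension by zero at infinity of a function in `C₀`. -/
def extendZero (φ : C₀(E d, ℝ)) : C(OnePoint (E d), ℝ) where
  toFun x := x.elim 0 φ
  continuous_toFun := by
    refine (OnePoint.continuous_iff _).2 ⟨?_, φ.continuous⟩
    rw [coclosedCompact_eq_cocompact]
    exact zero_at_infty φ

@[simp] theorem extendZero_coe (φ : C₀(E d, ℝ)) (a : E d) : extendZero φ (a : OnePoint (E d)) = φ a :=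
  rfl

@[simp] theorem extendZero_infty (φ : C₀(E d, ℝ)) : extendZero φ ∞ = 0 := rfl

/-! ### Strong duality -/

/-- The functions `ω ↦ (1/N) ∑ φ(ω_i) + c` on the compactified configuration space. -/
def averageSubmodule (d N : ℕ) : Submodule ℝ C(Fin N → OnePoint (E d), ℝ) where
  carrier := {h | ∃ (φ : C₀(E d, ℝ)) (c : ℝ), ∀ ω, h ω = (N : ℝ)⁻¹ * ∑ i, extendZero φ (ω i) + c}
  zero_mem' := ⟨0, 0, fun ω => by
    have : ∀ x : OnePoint (E d), extendZero 0 x = 0 := fun x => by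
      induction x using OnePoint.rec <;> rfl
    simp [this]⟩
  add_mem' := by
    rintro h h' ⟨φ, c, hφ⟩ ⟨φ', c', hφ'⟩
    refine ⟨φ + φ', c + c', fun ω => ?_⟩
    have : ∀ x : OnePoint (E d), extendZero (φ + φ') x = extendZero φ x + extendZero φ' x :=
      fun x => by induction x using OnePoint.rec <;> simp
    rw [ContinuousMap.add_apply, hφ, hφ']
    simp only [this, Finset.sum_add_distrib]
    ring
  smul_mem' := by
    rintro a h ⟨φ, c, hφ⟩
    refine ⟨a • φ, a * c, fun ω => ?_⟩
    have : ∀ x : OnePoint (E d), extendZero (a • φ) x = a * extendZero φ x :=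
      fun x => by induction x using OnePoint.rec <;> simp
    rw [ContinuousMap.smul_apply, hφ]
    simp only [this, ← Finset.mul_sum, smul_eq_mul]
    ring

theorem integrable_diagonal {N : ℕ} (ρ : Measure (E d)) [IsFiniteMeasure ρ]
    (h : C(Fin N → OnePoint (E d), ℝ)) : Integrable (fun x : E d => h fun _ => x) ρ := by
  have hc : Continuous fun x : E d => h fun _ => (x : OnePoint (E d)) :=
    h.continuous.comp (continuous_pi fun _ => OnePoint.continuous_coe)
  exact Integrable.of_bound hc.aestronglyMeasurable ‖h‖
    (Eventually.of_forall fun x => h.norm_coe_le_norm _)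

/-- Integration over the diagonal against `ρ + (1 - ‖ρ‖) δ_∞`. -/
def diagonalFunctional (N : ℕ) (ρ : Measure (E d)) [IsFiniteMeasure ρ] :
    C(Fin N → OnePoint (E d), ℝ) →ₗ[ℝ] ℝ where
  toFun h := ∫ x : E d, h (fun _ => x) ∂ρ + (1 - ρ.real Set.univ) * h fun _ => ∞
  map_add' h h' := by
    simp only [ContinuousMap.add_apply]
    rw [integral_add (integrable_diagonal ρ h) (integrable_diagonal ρ h')]
    ring
  map_smul' a h := by
    simp only [ContinuousMap.smul_apply, smul_eq_mul, RingHom.id_apply]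
    rw [integral_const_mul]
    ring

theorem diagonalFunctional_apply {N : ℕ} (ρ : Measure (E d)) [IsFiniteMeasure ρ]
    (h : C(Fin N → OnePoint (E d), ℝ)) : diagonalFunctional N ρ h =
      ∫ x : E d, h (fun _ => x) ∂ρ + (1 - ρ.real Set.univ) * h fun _ => ∞ := rfl

theorem diagonalFunctional_average {N : ℕ} (hN : 1 ≤ N) (ρ : Measure (E d)) [IsFiniteMeasure ρ]
    {h : C(Fin N → OnePoint (E d), ℝ)} {φ : C₀(E d, ℝ)} {c : ℝ}
    (hh : ∀ ω, h ω = (N : ℝ)⁻¹ * ∑ i, extendZero φ (ω i) + c) :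
    diagonalFunctional N ρ h = ∫ x, φ x ∂ρ + c := by
  have hN0 : (N : ℝ) ≠ 0 := by positivity
  have h1 : ∀ x : E d, h (fun _ => x) = φ x + c := fun x => by
    rw [hh]
    simp [hN0]
  have h2 : h (fun _ => ∞) = c := by
    rw [hh]
    simp
  rw [diagonalFunctional_apply]
  simp only [h1, h2]
  rw [integral_add (integrable_zeroAtInfty ρ φ) (integrable_const c), integral_const, smul_eq_mul]
  ring

/-- This checks the hypothesis of `exists_measure_of_dual_bound`. For `t = 0` the function `h` is
nonnegative and the functional is positive; for `t > 0`, division by `t` turns the constraint into a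
bound on `M` at `-φ/t`, to which the dual bound `D` applies. -/
theorem diagonalFunctional_nonneg {N : ℕ} (hN : 1 ≤ N) (ρ : Measure (E d)) [IsFiniteMeasure ρ]
    [Nontrivial (E d)] (hρ : ρ Set.univ ≤ 1) {D : ℝ} (hD : ∀ ψ, dualValue N ρ ψ ≤ D)
    {h : C(Fin N → OnePoint (E d), ℝ)} (hh : h ∈ averageSubmodule d N) {t : ℝ} (ht : 0 ≤ t)
    (hht : ∀ ω, ENNReal.ofReal (-h ω) ≤ ENNReal.ofReal t * compactCoulomb ω) :
    0 ≤ diagonalFunctional N ρ h + t * D := by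
  have hm : 0 ≤ 1 - ρ.real Set.univ := by
    have := ENNReal.toReal_mono ENNReal.one_ne_top hρ
    rw [ENNReal.toReal_one] at this
    simpa [measureReal_def] using this
  rcases ht.eq_or_lt with rfl | ht
  · have h0 : ∀ ω, 0 ≤ h ω := fun ω => by simpa using hht ω
    rw [zero_mul, add_zero, diagonalFunctional_apply]
    exact add_nonneg (integral_nonneg fun x => h0 _) (mul_nonneg hm (h0 _))
  · obtain ⟨φ, c, hφ⟩ := hh
    rw [diagonalFunctional_average hN ρ hφ]
    have hM : M N (-t⁻¹ • φ) ≤ t⁻¹ * c := by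
      refine M_le fun x hx => ?_
      have h1 := hht fun i => x i
      have h2 : compactCoulomb (fun i => (x i : OnePoint (E d))) = coulomb N x := rfl
      rw [h2, ← ENNReal.ofReal_toReal hx, ← ENNReal.ofReal_mul ht.le,
        ENNReal.ofReal_le_ofReal_iff (by positivity), hφ] at h1
      simp only [extendZero_coe] at h1
      simp only [ZeroAtInftyContinuousMap.smul_apply, smul_eq_mul, ← Finset.mul_sum, one_div]
      rw [← mul_le_mul_iff_right₀ ht]
      field_simp
      field_simp at h1
      linarith
    have h3 := hD (-t⁻¹ • φ)
    rw [dualValue] at h3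
    simp only [ZeroAtInftyContinuousMap.smul_apply, smul_eq_mul] at h3
    rw [integral_const_mul] at h3
    have h4 : t * (-t⁻¹ * ∫ x, φ x ∂ρ - t⁻¹ * c) ≤ t * D :=
      mul_le_mul_of_nonneg_left (by linarith) ht.le
    have h5 : t * (-t⁻¹ * ∫ x, φ x ∂ρ - t⁻¹ * c) = -∫ x, φ x ∂ρ - c := by
      field_simp
    linarith

/-- The map sends infinity to the arbitrary value `0`, so the preimage of an open set is an open
set, with the closed fibre over infinity added when the set contains `0`. -/
theorem measurable_elim_comp {K : Type*} [TopologicalSpace K] [MeasurableSpace K] [BorelSpace K]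
    {e : K → OnePoint (E d)} (he : Continuous e) :
    Measurable fun ω => (e ω).elim 0 (id : E d → E d) := by
  refine measurable_of_isOpen fun s hs => ?_
  have h1 : (fun ω => (e ω).elim 0 (id : E d → E d)) ⁻¹' s =
      e ⁻¹' ((fun a : E d => (a : OnePoint (E d))) '' s) ∪
        (e ⁻¹' {OnePoint.infty} ∩ {_x | (0 : E d) ∈ s}) := by
    ext ω
    simp only [Set.mem_preimage, Set.mem_union, Set.mem_inter_iff, Set.mem_ofPred_eq]
    induction e ω using OnePoint.rec <;> simp
  rw [h1]
  exact ((OnePoint.isOpen_image_coe.2 hs).preimage he).measurableSet.union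
    ((OnePoint.isClosed_infty.preimage he).measurableSet.inter (MeasurableSet.const _))

/-- The finite part of the average of the marginals of a plan on the compactified space is
determined by the integrals of functions in `C₀`. -/
theorem average_marginals_eq {K : Type*} [TopologicalSpace K] [MeasurableSpace K] [BorelSpace K]
    {N : ℕ} (e : Fin N → K → OnePoint (E d)) (he : ∀ i, Continuous (e i)) (P : Measure K)
    [IsFiniteMeasure P] (hN : 1 ≤ N) (ρ : Measure (E d)) [IsFiniteMeasure ρ]
    (h : ∀ φ : C₀(E d, ℝ), (N : ℝ)⁻¹ * ∑ i, ∫ ω, extendZero φ (e i ω) ∂P = ∫ x, φ x ∂ρ) :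
    (N : ℝ≥0∞)⁻¹ • ∑ i, (P.restrict {ω | e i ω ≠ OnePoint.infty}).map
      (fun ω => (e i ω).elim 0 (id : E d → E d)) = ρ := by
  have hN0 : (N : ℝ≥0∞)⁻¹ ≠ ⊤ := by
    rw [ne_eq, ENNReal.inv_eq_top]
    exact_mod_cast (by omega : N ≠ 0)
  set μ : Measure (E d) := ∑ i, (P.restrict {ω | e i ω ≠ OnePoint.infty}).map
      (fun ω => (e i ω).elim 0 (id : E d → E d)) with hμ
  have : IsFiniteMeasure ((N : ℝ≥0∞)⁻¹ • μ) := Measure.smul_finite μ hN0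
  refine Measure.ext_of_integral_eq_on_compactlySupported fun f => ?_
  let φ : C₀(E d, ℝ) := ⟨f.toContinuousMap, f.hasCompactSupport.is_zero_at_infty⟩
  have hφ : ∀ x, f x = φ x := fun x => rfl
  simp only [hφ]
  rw [← h φ, integral_smul_measure, smul_eq_mul, ENNReal.toReal_inv, ENNReal.toReal_natCast, hμ,
    integral_finsetSum_measure fun i _ => integrable_zeroAtInfty _ φ]
  congr 1
  refine Finset.sum_congr rfl fun i _ => ?_
  have hset : MeasurableSet {ω | e i ω ≠ OnePoint.infty} :=
    (OnePoint.isClosed_infty.preimage (he i)).measurableSet.compl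
  rw [integral_map (f := φ) (measurable_elim_comp (he i)).aemeasurable
    φ.continuous.aestronglyMeasurable, ← integral_indicator hset]
  congr 1
  ext ω
  by_cases hω : e i ω = OnePoint.infty
  · rw [Set.indicator_of_notMem (by simpa using hω), hω, extendZero_infty]
  · rw [Set.indicator_of_mem (by simpa using hω)]
    obtain ⟨a, ha⟩ := OnePoint.ne_infty_iff_exists.1 hω
    rw [← ha]
    rfl

/-- Strong duality: an upper bound for the dual problem is attained by a decomposition. -/
theorem exists_decomposition_of_dual_bound {N : ℕ} (hN : 1 ≤ N) [Nontrivial (E d)]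
    (ρ : Measure (E d)) (hρ : ρ Set.univ ≤ 1) {D : ℝ} (hD : ∀ ψ, dualValue N ρ ψ ≤ D) :
    ∃ r, IsDecomposition N ρ r ∧ stratifiedCost N r ≤ ENNReal.ofReal D := by
  have : IsFiniteMeasure ρ := ⟨hρ.trans_lt ENNReal.one_lt_top⟩
  let K := Fin N → OnePoint (E d)
  let mK : MeasurableSpace K := borel K
  have bK : BorelSpace K := ⟨rfl⟩
  have hzero : ∀ x : OnePoint (E d), extendZero 0 x = 0 := fun x => by
    induction x using OnePoint.rec <;> rfl
  have hone : ∀ ω : K, (1 : C(K, ℝ)) ω = (N : ℝ)⁻¹ * ∑ i, extendZero 0 (ω i) + 1 := fun ω => by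
    simp [hzero]
  obtain ⟨P, hP, hPavg, hPle⟩ := exists_measure_of_dual_bound (K := K) compactCoulomb
    (averageSubmodule d N) ⟨0, 1, hone⟩ (diagonalFunctional N ρ) D
    fun h hh t ht => diagonalFunctional_nonneg hN ρ hρ hD hh ht
  have he : ∀ i, Continuous fun ω : K => ω i := fun i => continuous_apply i
  have hmass : P Set.univ ≤ 1 := by
    have h1 := hPavg 1 ⟨0, 1, hone⟩
    rw [diagonalFunctional_average hN ρ hone] at h1
    simp only [ContinuousMap.one_apply, integral_const, smul_eq_mul, mul_one,
      ZeroAtInftyContinuousMap.zero_apply, mul_zero, zero_add] at h1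
    rw [measureReal_def] at h1
    rw [← ENNReal.ofReal_toReal (measure_ne_top P Set.univ), h1, ENNReal.ofReal_one]
  have havg : ∀ φ : C₀(E d, ℝ),
      (N : ℝ)⁻¹ * ∑ i, ∫ ω : K, extendZero φ (ω i) ∂P = ∫ x, φ x ∂ρ := by
    intro φ
    let h : C(K, ℝ) := ⟨fun ω => (N : ℝ)⁻¹ * ∑ i, extendZero φ (ω i), by fun_prop⟩
    have hh : ∀ ω, h ω = (N : ℝ)⁻¹ * ∑ i, extendZero φ (ω i) + 0 := fun ω => (add_zero _).symm
    have h1 := hPavg h ⟨φ, 0, hh⟩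
    rw [diagonalFunctional_average hN ρ hh, add_zero] at h1
    rw [← h1]
    change _ = ∫ ω : K, (N : ℝ)⁻¹ * ∑ i, extendZero φ (ω i) ∂P
    rw [integral_const_mul, integral_finsetSum]
    intro i _
    have hc : Continuous fun ω : K => extendZero φ (ω i) := (extendZero φ).continuous.comp (he i)
    exact Integrable.of_bound hc.aestronglyMeasurable ‖extendZero φ‖
      (Eventually.of_forall fun ω => (extendZero φ).norm_coe_le_norm _)
  have hcost : ∫⁻ ω, compactCoulomb ω ∂P ≤ ENNReal.ofReal D := by
    have h1 : ∀ n, ∫⁻ ω, ENNReal.ofReal (truncCoulomb N n ω) ∂P ≤ ENNReal.ofReal D := by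
      intro n
      rw [← ofReal_integral_eq_lintegral_ofReal]
      · exact ENNReal.ofReal_le_ofReal (hPle _ (ofReal_truncCoulomb_le N n))
      · exact Integrable.of_bound (truncCoulomb N n).continuous.aestronglyMeasurable
          ‖truncCoulomb (d := d) N n‖
          (Eventually.of_forall fun ω => (truncCoulomb N n).norm_coe_le_norm _)
      · refine Eventually.of_forall fun ω => ?_
        change 0 ≤ ∑ i, ∑ j ∈ Finset.Ioi i, extendPair (truncCost n) (ω i) (ω j)
        exact Finset.sum_nonneg fun i _ => Finset.sum_nonneg fun j _ =>
          extendPair_truncCost_nonneg n _ _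
    -- The cost bound is known for continuous minorants only; Fatou's lemma passes it to the
    -- singular cost.
    calc ∫⁻ ω, compactCoulomb ω ∂P
        = ∫⁻ ω, liminf (fun n => ENNReal.ofReal (truncCoulomb N n ω)) atTop ∂P :=
          lintegral_congr fun ω => (tendsto_truncCoulomb N ω).liminf_eq.symm
      _ ≤ liminf (fun n => ∫⁻ ω, ENNReal.ofReal (truncCoulomb N n ω) ∂P) atTop :=
          lintegral_liminf_le fun n => (truncCoulomb N n).continuous.measurable.ennreal_ofReal
      _ ≤ ENNReal.ofReal D := liminf_le_of_le (by isBoundedDefault) fun b hb => by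
          obtain ⟨n, hn⟩ := hb.exists
          exact hn.trans (h1 n)
  -- A point counts as present when it is not at infinity.
  obtain ⟨r, hr, hrc⟩ := exists_decomposition P hmass
    (fun i (ω : K) => (ω i).elim 0 (id : E d → E d)) (fun i => measurable_elim_comp (he i))
    (fun i => {ω : K | ω i ≠ OnePoint.infty})
    (fun i => (OnePoint.isClosed_infty.preimage (he i)).measurableSet.compl)
  rw [average_marginals_eq (fun i (ω : K) => ω i) he P hN ρ havg] at hr
  refine ⟨r, hr, hrc.trans (le_trans (le_of_eq ?_) hcost)⟩
  refine lintegral_congr fun ω => Finset.sum_congr rfl fun i _ => Finset.sum_congr rfl fun j _ => ?_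
  by_cases hi : ω i = OnePoint.infty
  · rw [Set.indicator_of_notMem (fun h => h.1 hi), hi]
    rfl
  · by_cases hj : ω j = OnePoint.infty
    · rw [Set.indicator_of_notMem (fun h => h.2 hj), hj]
      obtain ⟨a, ha⟩ := OnePoint.ne_infty_iff_exists.1 hi
      rw [← ha]
      rfl
    · have hij : ω ∈ {ω : K | ω i ≠ OnePoint.infty} ∩ {ω : K | ω j ≠ OnePoint.infty} := ⟨hi, hj⟩
      rw [Set.indicator_of_mem hij]
      obtain ⟨a, ha⟩ := OnePoint.ne_infty_iff_exists.1 hi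
      obtain ⟨b, hb⟩ := OnePoint.ne_infty_iff_exists.1 hj
      rw [← ha, ← hb]
      rfl

/-- For a measure of mass one, the only component of a decomposition is the last one. -/
theorem IsDecomposition.eq_of_measure_univ_eq_one {k : ℕ} (hk : 1 ≤ k) {μ : Measure (E d)}
    (hμ : μ Set.univ = 1) {r : ℕ → Measure (E d)} (hr : IsDecomposition k μ r) : r k = μ := by
  have hk0 : (k : ℝ≥0∞) ≠ 0 := by exact_mod_cast (by omega : k ≠ 0)
  have hsplit : Finset.Icc 1 k = insert k (Finset.Ico 1 k) := (Finset.Ico_insert_right hk).symm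
  have h1 := hr.1
  have h2 := hr.2
  have h3 : ∑ l ∈ Finset.Icc 1 k, ((l : ℝ≥0∞) / k) * r l Set.univ = 1 := by
    rw [← hμ, ← h1, Measure.finsetSum_apply]
    rfl
  rw [hsplit, Finset.sum_insert (by simp)] at h1 h2 h3
  rw [ENNReal.div_self hk0 (ENNReal.natCast_ne_top k)] at h1 h3
  rw [one_mul] at h3
  have hkt : r k Set.univ ≠ ⊤ := ne_top_of_le_ne_top ENNReal.one_ne_top (le_self_add.trans h2)
  -- Since `∑ ‖r l‖ ≤ 1 = ∑ (l/k) ‖r l‖`, cancelling the term `l = k` bounds the lower masses by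
  -- their weighted sum, whose weights are at most `(k-1)/k < 1`; so they vanish.
  have h4 : ∑ l ∈ Finset.Ico 1 k, r l Set.univ ≤
      ∑ l ∈ Finset.Ico 1 k, ((l : ℝ≥0∞) / k) * r l Set.univ := by
    rw [← h3] at h2
    exact (ENNReal.add_le_add_iff_left hkt).1 h2
  set s := ∑ l ∈ Finset.Ico 1 k, r l Set.univ
  have hst : s ≠ ⊤ := ne_top_of_le_ne_top ENNReal.one_ne_top (le_add_self.trans h2)
  have hq : (((k - 1 : ℕ) : ℝ≥0∞) / k) < 1 := by
    refine ENNReal.div_lt_of_lt_mul ?_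
    rw [one_mul]
    exact_mod_cast (by omega : k - 1 < k)
  have hs : s ≤ (((k - 1 : ℕ) : ℝ≥0∞) / k) * s := by
    refine h4.trans ?_
    rw [Finset.mul_sum]
    refine Finset.sum_le_sum fun l hl => mul_le_mul_left (ENNReal.div_le_div_right ?_ _) _
    have := (Finset.mem_Ico.1 hl).2
    exact_mod_cast (by omega : l ≤ k - 1)
  have hs0 : s = 0 := by
    by_contra hs0
    refine absurd hs (not_le.2 ?_)
    calc (((k - 1 : ℕ) : ℝ≥0∞) / k) * s < 1 * s := ENNReal.mul_lt_mul_left hs0 hst hq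
      _ = s := one_mul s
  have h5 : ∀ l ∈ Finset.Ico 1 k, r l = 0 := fun l hl =>
    Measure.measure_univ_eq_zero.1 (Finset.sum_eq_zero_iff.1 hs0 l hl)
  rw [Finset.sum_eq_zero fun l hl => by rw [h5 l hl, smul_zero], add_zero, one_smul] at h1
  exact h1

/-- Strong duality for the partial costs. -/
theorem partialCost_le_of_dual_bound {k : ℕ} (hk : 1 ≤ k) [Nontrivial (E d)]
    (μ : Measure (E d)) (hμ : μ Set.univ ≤ 1) {B : ℝ} (hB : ∀ ψ, partialDualValue k μ ψ ≤ B) :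
    partialCost k μ ≤ ENNReal.ofReal B := by
  have : IsFiniteMeasure μ := ⟨hμ.trans_lt ENNReal.one_lt_top⟩
  by_cases h0 : μ = 0
  · rw [h0, partialCost_zero]
    exact bot_le
  set m : ℝ≥0∞ := μ Set.univ
  have hm0 : m ≠ 0 := fun h => h0 (Measure.measure_univ_eq_zero.1 h)
  have hmt : m ≠ ⊤ := measure_ne_top μ _
  have hmr : 0 < m.toReal := ENNReal.toReal_pos hm0 hmt
  have hmass : (m⁻¹ • μ) Set.univ = 1 := by
    rw [Measure.smul_apply, smul_eq_mul, ENNReal.inv_mul_cancel hm0 hmt]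
  -- After normalization to mass one, the partial dual problem is the full dual problem with `N =
  -- k`, and the decomposition found has the measure itself as its last component.
  obtain ⟨r, hr, hrc⟩ := exists_decomposition_of_dual_bound hk (m⁻¹ • μ) hmass.le
    (D := m.toReal⁻¹ * B) fun ψ => by
      have h1 : dualValue k (m⁻¹ • μ) ψ = m.toReal⁻¹ * partialDualValue k μ ψ := by
        rw [dualValue, partialDualValue, integral_smul_measure, ENNReal.toReal_inv, smul_eq_mul,
          measureReal_def]
        change _ = m.toReal⁻¹ * (_ - _ * m.toReal)
        field_simp
      rw [h1]
      exact mul_le_mul_of_nonneg_left (hB ψ) (by positivity)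
  have h2 : partialCost k (m⁻¹ • μ) ≤ ENNReal.ofReal (m.toReal⁻¹ * B) := by
    refine le_trans ?_ hrc
    rw [← hr.eq_of_measure_univ_eq_one hk hmass]
    exact Finset.single_le_sum (f := fun k => partialCost k (r k)) (fun _ _ => bot_le)
      (Finset.mem_Icc.2 ⟨hk, le_rfl⟩)
  have h3 : μ = m • (m⁻¹ • μ) := by
    rw [smul_smul, ENNReal.mul_inv_cancel hm0 hmt, one_smul]
  rw [h3]
  refine (partialCost_smul_le k _ hm0 hmt).trans ((mul_le_mul_right h2 _).trans (le_of_eq ?_))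
  nth_rw 1 [← ENNReal.ofReal_toReal hmt]
  rw [← ENNReal.ofReal_mul hmr.le]
  congr 1
  field_simp

end Compactification

/-! ### Maximizing sequences -/

/-- Only the lower bound carries information, since no value exceeds the supremum. In this form an
infinite supremum needs no separate treatment. -/
theorem isMaximizing_iff {F : C₀(E d, ℝ) → ℝ} {φ : ℕ → C₀(E d, ℝ)} :
    IsMaximizing F φ ↔ ∀ (ψ : C₀(E d, ℝ)) (c : ℝ), c < F ψ → ∀ᶠ n in atTop, c < F (φ n) := by
  constructor
  · intro h ψ c hc
    have h1 : (c : EReal) < ⨆ ψ : C₀(E d, ℝ), ((F ψ : ℝ) : EReal) :=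
      lt_of_lt_of_le (EReal.coe_lt_coe_iff.2 hc) (le_iSup (fun ψ => ((F ψ : ℝ) : EReal)) ψ)
    filter_upwards [h.eventually_const_lt h1] with n hn
    exact EReal.coe_lt_coe_iff.1 hn
  · intro h
    refine tendsto_order.2 ⟨fun a ha => ?_, fun a ha => ?_⟩
    · obtain ⟨ψ, hψ⟩ := lt_iSup_iff.1 ha
      obtain ⟨c, hac, hcψ⟩ := EReal.lt_iff_exists_real_btwn.1 hψ
      filter_upwards [h ψ c (EReal.coe_lt_coe_iff.1 hcψ)] with n hn
      exact hac.trans (EReal.coe_lt_coe_iff.2 hn)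
    · exact Eventually.of_forall fun n =>
        lt_of_le_of_lt (le_iSup (fun ψ => ((F ψ : ℝ) : EReal)) (φ n)) ha

theorem isMaximizing_const_iff {F : C₀(E d, ℝ) → ℝ} {φ : C₀(E d, ℝ)} :
    IsMaximizing F (fun _ => φ) ↔ IsOptimal F φ := by
  rw [isMaximizing_iff]
  simp only [eventually_const]
  exact forall_congr' fun ψ => forall_lt_iff_le

theorem optimalityConditions_iff {N : ℕ} {r : ℕ → Measure (E d)} {φ : C₀(E d, ℝ)} :
    OptimalityConditions N r φ ↔ AsymptoticOptimalityConditions N r fun _ => φ := by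
  have h : ∀ a b : ℝ, Tendsto (fun _ : ℕ => a - b) atTop (𝓝 0) ↔ b = a := fun a b => by
    rw [tendsto_const_nhds_iff, sub_eq_zero, eq_comm]
  simp only [OptimalityConditions, AsymptoticOptimalityConditions, isMaximizing_const_iff, h]

/-! ### Decompositions -/

variable {N : ℕ} {ρ : Measure (E d)} {r : ℕ → Measure (E d)}

theorem IsDecomposition.measure_univ_le_one (hr : IsDecomposition N ρ r) {k : ℕ}
    (hk : k ∈ Finset.Icc 1 N) : r k Set.univ ≤ 1 :=
  (Finset.single_le_sum (f := fun k => r k Set.univ) (fun _ _ => bot_le) hk).trans hr.2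

theorem IsDecomposition.isFiniteMeasure (hr : IsDecomposition N ρ r) {k : ℕ}
    (hk : k ∈ Finset.Icc 1 N) : IsFiniteMeasure (r k) :=
  ⟨(hr.measure_univ_le_one hk).trans_lt ENNReal.one_lt_top⟩

theorem IsDecomposition.sum_real (hr : IsDecomposition N ρ r) :
    ∑ k ∈ Finset.Icc 1 N, (r k).real Set.univ = (∑ k ∈ Finset.Icc 1 N, r k Set.univ).toReal :=
  (ENNReal.toReal_sum fun _ hk =>
    ne_top_of_le_ne_top ENNReal.one_ne_top (hr.measure_univ_le_one hk)).symm

theorem IsDecomposition.sum_real_le (hr : IsDecomposition N ρ r) :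
    ∑ k ∈ Finset.Icc 1 N, (r k).real Set.univ ≤ 1 := by
  rw [hr.sum_real]
  exact ENNReal.toReal_le_of_le_ofReal zero_le_one (by simpa using hr.2)

theorem IsDecomposition.integral_eq (hr : IsDecomposition N ρ r) (ψ : C₀(E d, ℝ)) :
    ∫ x, ψ x ∂ρ = ∑ k ∈ Finset.Icc 1 N, ∫ x, (((k : ℝ) / N) • ψ) x ∂(r k) := by
  rw [← hr.1, integral_finsetSum_measure]
  · refine Finset.sum_congr rfl fun k hk => ?_
    rw [integral_smul_measure]
    simp only [ZeroAtInftyContinuousMap.smul_apply]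
    rw [integral_smul, ENNReal.toReal_div, ENNReal.toReal_natCast, ENNReal.toReal_natCast]
  · intro k hk
    have := hr.isFiniteMeasure hk
    have h1 := Finset.mem_Icc.1 hk
    refine (integrable_zeroAtInfty (r k) ψ).smul_measure ?_
    exact ENNReal.div_ne_top (ENNReal.natCast_ne_top k) (by exact_mod_cast (by omega : N ≠ 0))

/-- The dual value as the sum of the partial dual values, minus the gaps. -/
theorem IsDecomposition.dualValue_eq (hr : IsDecomposition N ρ r) (ψ : C₀(E d, ℝ)) :
    dualValue N ρ ψ = ∑ k ∈ Finset.Icc 1 N, partialDualValue k (r k) (((k : ℝ) / N) • ψ) -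
      ∑ k ∈ Finset.Icc 1 N, (M N ψ - M k (((k : ℝ) / N) • ψ)) * (r k).real Set.univ -
      M N ψ * (1 - ∑ k ∈ Finset.Icc 1 N, (r k).real Set.univ) := by
  simp only [dualValue, partialDualValue, hr.integral_eq ψ, sub_mul, Finset.sum_sub_distrib,
    ← Finset.mul_sum]
  ring

/-- Zero cost kills all components with `k ≥ 2`, leaving `ρ = ρ_1/N`, of mass at most `1/N`. -/
theorem IsDecomposition.stratifiedCost_ne_zero (hr : IsDecomposition N ρ r) (hN : 1 ≤ N)
    (hρN : 1 / (N : ℝ≥0∞) < ρ Set.univ) : stratifiedCost N r ≠ 0 := by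
  intro h0
  have h1 : ∀ k ∈ Finset.Icc 1 N, k ≠ 1 → r k = 0 := fun k hk hk1 => by
    have := hr.isFiniteMeasure hk
    exact eq_zero_of_partialCost_eq_zero (by have := (Finset.mem_Icc.1 hk).1; omega) (r k)
      (Finset.sum_eq_zero_iff.1 h0 k hk)
  have h1N : 1 ∈ Finset.Icc 1 N := Finset.mem_Icc.2 ⟨le_rfl, hN⟩
  refine absurd hρN (not_lt.2 ?_)
  rw [← hr.1, Finset.sum_eq_single_of_mem 1 h1N fun k hk hk1 => by rw [h1 k hk hk1, smul_zero],
    Measure.smul_apply, smul_eq_mul, Nat.cast_one]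
  exact (mul_le_mul_right (hr.measure_univ_le_one h1N) _).trans (mul_one _).le

/-! ### Complementary slackness between decompositions and potentials -/

section Nontrivial

variable [Nontrivial (E d)]

theorem gap_nonneg {k : ℕ} (hk : k ∈ Finset.Icc 1 N) (ψ : C₀(E d, ℝ)) :
    0 ≤ M N ψ - M k (((k : ℝ) / N) • ψ) :=
  sub_nonneg.2 (M_div_smul_le (Finset.mem_Icc.1 hk).1 (Finset.mem_Icc.1 hk).2 ψ)

theorem IsDecomposition.dualValue_le_sum (hr : IsDecomposition N ρ r) (hN : 1 ≤ N)
    (ψ : C₀(E d, ℝ)) :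
    dualValue N ρ ψ ≤ ∑ k ∈ Finset.Icc 1 N, partialDualValue k (r k) (((k : ℝ) / N) • ψ) := by
  rw [hr.dualValue_eq ψ]
  have h1 : 0 ≤ ∑ k ∈ Finset.Icc 1 N, (M N ψ - M k (((k : ℝ) / N) • ψ)) * (r k).real Set.univ :=
    Finset.sum_nonneg fun k hk => mul_nonneg (gap_nonneg hk ψ) measureReal_nonneg
  have h2 := mul_nonneg (M_nonneg hN ψ) (sub_nonneg.2 hr.sum_real_le)
  linarith

/-- Partial dual values may be negative, so they are replaced by their positive parts before weak
duality is applied to each term in `ℝ≥0∞`. -/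
theorem IsDecomposition.dualValue_le_stratifiedCost (hr : IsDecomposition N ρ r) (hN : 1 ≤ N)
    (ψ : C₀(E d, ℝ)) : ENNReal.ofReal (dualValue N ρ ψ) ≤ stratifiedCost N r := by
  have h1 : dualValue N ρ ψ ≤
      ∑ k ∈ Finset.Icc 1 N, max (partialDualValue k (r k) (((k : ℝ) / N) • ψ)) 0 :=
    (hr.dualValue_le_sum hN ψ).trans (Finset.sum_le_sum fun k _ => le_max_left _ _)
  refine (ENNReal.ofReal_le_ofReal h1).trans ?_
  rw [ENNReal.ofReal_sum_of_nonneg fun k _ => le_max_right _ _]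
  refine Finset.sum_le_sum fun k hk => ?_
  have := hr.isFiniteMeasure hk
  rw [ENNReal.ofReal_max, ENNReal.ofReal_zero, max_eq_left zero_le]
  exact partialDualValue_le (Finset.mem_Icc.1 hk).1 (r k) _

theorem partialDualValue_zero_nonneg (k : ℕ) (μ : Measure (E d)) :
    0 ≤ partialDualValue k μ 0 := by
  have := mul_nonneg (neg_nonneg.2 (M_zero_le (d := d) k)) (measureReal_nonneg (μ := μ) (s := Set.univ))
  simp only [partialDualValue, ZeroAtInftyContinuousMap.zero_apply, integral_zero]
  linarith

theorem dualValue_zero_nonneg (N : ℕ) (ρ : Measure (E d)) : 0 ≤ dualValue N ρ 0 := by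
  simpa [dualValue] using M_zero_le (d := d) N

/-- If all dual values stayed below some `a < 𝒞_k(μ)`, strong duality would give `𝒞_k(μ) ≤ a`. The
case `𝒞_k(μ) = ∞` is included. -/
theorem tendsto_partialDualValue {k : ℕ} (hk : 1 ≤ k) {μ : Measure (E d)} (hμ : μ Set.univ ≤ 1)
    {ψ : ℕ → C₀(E d, ℝ)} (h : IsMaximizing (partialDualValue k μ) ψ) :
    Tendsto (fun n => ENNReal.ofReal (partialDualValue k μ (ψ n))) atTop (𝓝 (partialCost k μ)) := by
  have : IsFiniteMeasure μ := ⟨hμ.trans_lt ENNReal.one_lt_top⟩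
  refine tendsto_order.2 ⟨fun a ha => ?_, fun a ha => Eventually.of_forall fun n =>
    (partialDualValue_le hk μ (ψ n)).trans_lt ha⟩
  have hat : a ≠ ∞ := ne_top_of_lt ha
  obtain ⟨ψ', hψ'⟩ : ∃ ψ', a.toReal < partialDualValue k μ ψ' := by
    by_contra! hle
    have := partialCost_le_of_dual_bound hk μ hμ hle
    rw [ENNReal.ofReal_toReal hat] at this
    exact absurd ha (not_lt.2 this)
  filter_upwards [isMaximizing_iff.1 h ψ' _ hψ'] with n hn
  exact (ENNReal.lt_ofReal_iff_toReal_lt hat).2 hn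

/-- Sufficiency of the optimality conditions. -/
theorem isOptimalDecomposition_of_conditions (hN : 1 ≤ N) (hr : IsDecomposition N ρ r)
    {φ : ℕ → C₀(E d, ℝ)} (h : AsymptoticOptimalityConditions N r φ) :
    IsOptimalDecomposition N ρ r ∧ IsMaximizing (dualValue N ρ) φ := by
  obtain ⟨hmass, hmax, hgap⟩ := h
  set b : ℕ → ℕ → ℝ := fun k n => partialDualValue k (r k) (((k : ℝ) / N) • φ n) with hb
  set e : ℕ → ℝ := fun n => ∑ k ∈ Finset.Icc 1 N,
    (M N (φ n) - M k (((k : ℝ) / N) • φ n)) * (r k).real Set.univ with he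
  have hv : ∀ n, dualValue N ρ (φ n) = ∑ k ∈ Finset.Icc 1 N, b k n - e n := fun n => by
    rw [hr.dualValue_eq (φ n), hr.sum_real, hmass]
    simp [hb, he]
  have he0 : Tendsto e atTop (𝓝 0) := by
    have : Tendsto e atTop (𝓝 (∑ _k ∈ Finset.Icc 1 N, 0)) := by
      refine tendsto_finsetSum _ fun k hk => ?_
      rcases eq_or_ne (r k Set.univ) 0 with h0 | h0
      · simp [measureReal_def, h0]
      · have h1 := hgap k hk ⟨k, Finset.mem_Icc.2 ⟨(Finset.mem_Icc.1 hk).1, le_rfl⟩,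
          pos_iff_ne_zero.2 h0⟩
        simpa using h1.mul_const ((r k).real Set.univ)
    simpa using this
  refine ⟨⟨hr, fun r' hr' => ?_⟩, isMaximizing_iff.2 fun ψ c hc => ?_⟩
  -- `ENNReal.ofReal` discards negative parts, so these must be shown to vanish in the limit; this
  -- holds because the competitor `0` has nonnegative partial dual value.
  · have hneg : Tendsto (fun n => ∑ k ∈ Finset.Icc 1 N, max (-b k n) 0) atTop (𝓝 0) := by
      have : Tendsto (fun n => ∑ k ∈ Finset.Icc 1 N, max (-b k n) 0) atTop
          (𝓝 (∑ _k ∈ Finset.Icc 1 N, 0)) := by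
        refine tendsto_finsetSum _ fun k hk => tendsto_order.2
          ⟨fun a ha => Eventually.of_forall fun n => lt_of_lt_of_le ha (le_max_right _ _),
            fun a ha => ?_⟩
        filter_upwards [isMaximizing_iff.1 (hmax k hk) 0 (-a)
          (by linarith [partialDualValue_zero_nonneg k (r k)])] with n hn
        exact max_lt (neg_lt.1 hn) ha
      simpa using this
    have hlim : Tendsto (fun n => ∑ k ∈ Finset.Icc 1 N, ENNReal.ofReal (b k n)) atTop
        (𝓝 (stratifiedCost N r)) :=
      tendsto_finsetSum _ fun k hk => tendsto_partialDualValue (Finset.mem_Icc.1 hk).1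
        (hr.measure_univ_le_one hk) (hmax k hk)
    have hlim' : Tendsto (fun n => stratifiedCost N r' +
        ENNReal.ofReal (e n + ∑ k ∈ Finset.Icc 1 N, max (-b k n) 0)) atTop
        (𝓝 (stratifiedCost N r' + ENNReal.ofReal (0 + 0))) :=
      tendsto_const_nhds.add (ENNReal.tendsto_ofReal (he0.add hneg))
    rw [add_zero, ENNReal.ofReal_zero, add_zero] at hlim'
    refine le_of_tendsto_of_tendsto' hlim hlim' fun n => ?_
    have h1 : ∑ k ∈ Finset.Icc 1 N, ENNReal.ofReal (b k n) =
        ENNReal.ofReal (dualValue N ρ (φ n) +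
          (e n + ∑ k ∈ Finset.Icc 1 N, max (-b k n) 0)) := by
      have h2 : dualValue N ρ (φ n) + (e n + ∑ k ∈ Finset.Icc 1 N, max (-b k n) 0) =
          ∑ k ∈ Finset.Icc 1 N, max (b k n) 0 := by
        rw [hv, ← add_assoc, sub_add_cancel, ← Finset.sum_add_distrib]
        refine Finset.sum_congr rfl fun k _ => ?_
        rcases le_total (b k n) 0 with h | h
        · rw [max_eq_right h, max_eq_left (neg_nonneg.2 h), add_neg_cancel]
        · rw [max_eq_left h, max_eq_right (neg_nonpos.2 h), add_zero]
      rw [h2, ENNReal.ofReal_sum_of_nonneg fun k _ => le_max_right _ _]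
      refine Finset.sum_congr rfl fun k _ => ?_
      rw [ENNReal.ofReal_max, ENNReal.ofReal_zero, max_eq_left zero_le]
    rw [h1]
    exact ENNReal.ofReal_add_le.trans
      (add_le_add (hr'.dualValue_le_stratifiedCost hN (φ n)) le_rfl)
  · set δ : ℝ := dualValue N ρ ψ - c
    have hδ : 0 < δ := sub_pos.2 hc
    have hNpos : (0 : ℝ) < N := by exact_mod_cast hN
    -- The `N` errors `δ/(2N)` use up half of `δ`; the other half absorbs the weighted gaps `e n`.
    have h1 : ∀ᶠ n in atTop, ∀ k ∈ Finset.Icc 1 N,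
        partialDualValue k (r k) (((k : ℝ) / N) • ψ) - δ / (2 * N) < b k n :=
      (Finset.eventually_all _).2 fun k hk => isMaximizing_iff.1 (hmax k hk) _ _
        (sub_lt_self _ (by positivity))
    filter_upwards [h1, he0.eventually_lt_const (half_pos hδ)] with n hn hen
    have h2 := Finset.sum_le_sum fun k hk => (hn k hk).le
    rw [Finset.sum_sub_distrib, Finset.sum_const, Nat.card_Icc, nsmul_eq_mul] at h2
    have h3 : ((N + 1 - 1 : ℕ) : ℝ) * (δ / (2 * N)) = δ / 2 := by
      rw [Nat.add_sub_cancel]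
      field_simp
    have h4 := hr.dualValue_le_sum hN ψ
    rw [hv]
    rw [h3] at h2
    have h5 : c = dualValue N ρ ψ - δ := by simp [δ]
    linarith

/-- Necessity of the optimality conditions. -/
theorem conditions_of_isOptimalDecomposition (hN : 1 ≤ N) (hρ : ρ Set.univ ≤ 1)
    (hρN : 1 / (N : ℝ≥0∞) < ρ Set.univ) (hopt : IsOptimalDecomposition N ρ r)
    {φ : ℕ → C₀(E d, ℝ)} (hφ : IsMaximizing (dualValue N ρ) φ)
    (hbdd : BddAbove (Set.range (dualValue N ρ))) : AsymptoticOptimalityConditions N r φ := by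
  have hr := hopt.1
  have : IsFiniteMeasure ρ := ⟨hρ.trans_lt ENNReal.one_lt_top⟩
  set D : ℝ := ⨆ ψ, dualValue N ρ ψ
  have hle : ∀ ψ, dualValue N ρ ψ ≤ D := fun ψ => le_ciSup hbdd ψ
  have hD0 : 0 ≤ D := (dualValue_zero_nonneg N ρ).trans (hle 0)
  have hlim : Tendsto (fun n => dualValue N ρ (φ n)) atTop (𝓝 D) := by
    refine tendsto_order.2 ⟨fun a ha => ?_, fun a ha => Eventually.of_forall fun n =>
      (hle _).trans_lt ha⟩
    obtain ⟨ψ, hψ⟩ := exists_lt_of_lt_ciSup ha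
    exact isMaximizing_iff.1 hφ ψ a hψ
  obtain ⟨r', hr', hr'D⟩ := exists_decomposition_of_dual_bound hN ρ hρ hle
  -- Strong duality gives a competitor of cost at most `D`, so the optimal decomposition has no
  -- duality gap.
  have hcost : stratifiedCost N r ≤ ENNReal.ofReal D := (hopt.2 r' hr').trans hr'D
  have hfin : ∀ k ∈ Finset.Icc 1 N, partialCost k (r k) ≠ ∞ := fun k hk =>
    ne_top_of_le_ne_top ENNReal.ofReal_ne_top ((Finset.single_le_sum
      (f := fun k => partialCost k (r k)) (fun _ _ => bot_le) hk).trans hcost)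
  set q : ℕ → ℝ := fun k => (partialCost k (r k)).toReal
  have hq : ∀ k ∈ Finset.Icc 1 N, ∀ ψ, partialDualValue k (r k) ψ ≤ q k := fun k hk ψ => by
    have := hr.isFiniteMeasure hk
    have h1 := partialDualValue_le (Finset.mem_Icc.1 hk).1 (r k) ψ
    exact (ENNReal.ofReal_le_iff_le_toReal (hfin k hk)).1 h1
  have hqD : ∑ k ∈ Finset.Icc 1 N, q k ≤ D := by
    rw [← ENNReal.toReal_sum hfin]
    exact ENNReal.toReal_le_of_le_ofReal hD0 hcost
  set A : ℝ := ∑ k ∈ Finset.Icc 1 N, (r k).real Set.univ with hA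
  have hA1 : 0 ≤ 1 - A := sub_nonneg.2 hr.sum_real_le
  set u : ℕ → ℕ → ℝ := fun k n => q k - partialDualValue k (r k) (((k : ℝ) / N) • φ n) with hu
  set g : ℕ → ℕ → ℝ := fun k n => M N (φ n) - M k (((k : ℝ) / N) • φ n) with hg
  have hu0 : ∀ k ∈ Finset.Icc 1 N, ∀ n, 0 ≤ u k n := fun k hk n => sub_nonneg.2 (hq k hk _)
  have hg0 : ∀ k ∈ Finset.Icc 1 N, ∀ n, 0 ≤ g k n := fun k hk n => gap_nonneg hk _
  have hga0 : ∀ k ∈ Finset.Icc 1 N, ∀ n, 0 ≤ g k n * (r k).real Set.univ := fun k hk n =>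
    mul_nonneg (hg0 k hk n) measureReal_nonneg
  have hM0 : ∀ n, 0 ≤ M N (φ n) * (1 - A) := fun n => mul_nonneg (M_nonneg hN _) hA1
  -- The three nonnegative defects together are at most the distance of the dual value from its
  -- supremum, so each of them tends to zero.
  have hsum : ∀ n, ∑ k ∈ Finset.Icc 1 N, u k n +
      ∑ k ∈ Finset.Icc 1 N, g k n * (r k).real Set.univ + M N (φ n) * (1 - A) ≤
      D - dualValue N ρ (φ n) := fun n => by
    have h1 := hr.dualValue_eq (φ n)
    simp only [hu, Finset.sum_sub_distrib]
    rw [← hA] at h1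
    linarith
  have hdef : Tendsto (fun n => D - dualValue N ρ (φ n)) atTop (𝓝 0) := by
    simpa using (tendsto_const_nhds (x := D)).sub hlim
  have hu_lim : ∀ k ∈ Finset.Icc 1 N, Tendsto (u k) atTop (𝓝 0) := fun k hk => by
    refine squeeze_zero (hu0 k hk) (fun n => ?_) hdef
    have h1 := Finset.single_le_sum (f := fun k => u k n) (fun k hk => hu0 k hk n) hk
    have h2 := Finset.sum_nonneg fun k hk => hga0 k hk n
    linarith [hsum n, hM0 n]
  have hg_lim : ∀ k ∈ Finset.Icc 1 N, 0 < r k Set.univ → Tendsto (g k) atTop (𝓝 0) :=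
    fun k hk hpos => by
    have := hr.isFiniteMeasure hk
    have ha : (r k).real Set.univ ≠ 0 := by
      rw [measureReal_def]
      exact (ENNReal.toReal_pos hpos.ne' (measure_ne_top _ _)).ne'
    have h0 : Tendsto (fun n => g k n * (r k).real Set.univ) atTop (𝓝 0) := by
      refine squeeze_zero (hga0 k hk) (fun n => ?_) hdef
      have h1 := Finset.single_le_sum (f := fun k => g k n * (r k).real Set.univ)
        (fun k hk => hga0 k hk n) hk
      have h2 := Finset.sum_nonneg fun k hk => hu0 k hk n
      linarith [hsum n, hM0 n]
    simpa [ha] using h0.div_const ((r k).real Set.univ)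
  refine ⟨?_, fun k hk => isMaximizing_iff.2 fun ψ c hc => ?_, fun k hk ⟨l, hl, hlpos⟩ => ?_⟩
  -- With a mass deficit, the third defect forces `M_N(φ_n) → 0`. Since `φ_n ≤ N M_N(φ_n)`
  -- pointwise, the dual values have limit at most zero, so the cost is zero, contradicting `1/N <
  -- ‖ρ‖`.
  · by_contra hne
    have hAlt : 0 < 1 - A := by
      refine lt_of_le_of_ne hA1 fun h => hne ?_
      have h1 : A = 1 := by linarith
      rw [hA, hr.sum_real, ENNReal.toReal_eq_one_iff] at h1
      exact h1
    have hMlim : Tendsto (fun n => M N (φ n)) atTop (𝓝 0) := by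
      have h0 : Tendsto (fun n => M N (φ n) * (1 - A)) atTop (𝓝 0) := by
        refine squeeze_zero hM0 (fun n => ?_) hdef
        have h1 := Finset.sum_nonneg fun k hk => hga0 k hk n
        have h2 := Finset.sum_nonneg fun k hk => hu0 k hk n
        linarith [hsum n]
      simpa [hAlt.ne'] using h0.div_const (1 - A)
    have hvle : ∀ n, dualValue N ρ (φ n) ≤ M N (φ n) * (N * ρ.real Set.univ - 1) := fun n => by
      have h1 : ∫ x, φ n x ∂ρ ≤ ∫ _x, N * M N (φ n) ∂ρ :=
        integral_mono (integrable_zeroAtInfty ρ _) (integrable_const _)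
          fun x => apply_le_mul_M hN (φ n) x
      rw [integral_const, smul_eq_mul] at h1
      rw [dualValue]
      linarith
    have hD : D ≤ 0 := by
      refine le_of_tendsto_of_tendsto' hlim ?_ hvle
      simpa using hMlim.mul_const (N * ρ.real Set.univ - 1)
    rw [ENNReal.ofReal_of_nonpos hD] at hcost
    exact hr.stratifiedCost_ne_zero hN hρN (le_antisymm hcost bot_le)
  · have h1 : 0 < q k - c := sub_pos.2 (hc.trans_le (hq k hk ψ))
    filter_upwards [(hu_lim k hk).eventually_lt_const h1] with n hn
    simp only [hu] at hn
    linarith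
  · have hk' := Finset.mem_Icc.1 hk
    have hl' := Finset.mem_Icc.1 hl
    have hlN : l ∈ Finset.Icc 1 N := Finset.mem_Icc.2 ⟨hl'.1, hl'.2.trans hk'.2⟩
    -- By monotonicity in the number of points, the gap at `k` is at most the gap at the charged
    -- index `l ≤ k`.
    refine squeeze_zero (hg0 k hk) (fun n => ?_) (hg_lim l hlN hlpos)
    exact sub_le_sub_left (M_div_smul_mono hl'.1 hl'.2 (φ n)) _

end Nontrivial

/-- The dual problem bounds the relaxed cost from below. -/
theorem dualValue_le_relaxedCost (hN : 1 ≤ N) (ψ : C₀(E d, ℝ)) :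
    ENNReal.ofReal (dualValue N ρ ψ) ≤ relaxedCost N ρ := by
  refine le_iInf₂ fun ν hν => ?_
  have h1 : Tendsto (fun n => ENNReal.ofReal (dualValue N (ν n) ψ)) atTop
      (𝓝 (ENNReal.ofReal (dualValue N ρ ψ))) :=
    ENNReal.tendsto_ofReal ((hν.2 ψ).sub tendsto_const_nhds)
  rw [← h1.liminf_eq]
  refine liminf_le_liminf (Eventually.of_forall fun n => ?_)
  have := hν.1 n
  have h2 := partialDualValue_le hN (ν n) ψ
  simpa [partialDualValue, dualValue] using h2

end RelaxedCost

end

theorem mainTheorem5 (d N : ℕ) (hd : 1 ≤ d)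
    (ρ : MeasureTheory.Measure (RelaxedCost.E d)) (hρ : ρ Set.univ ≤ 1)
    (hρN : 1 / (N : ℝ≥0∞) < ρ Set.univ)
    (r : ℕ → MeasureTheory.Measure (RelaxedCost.E d))
    (hr : RelaxedCost.IsDecomposition N ρ r) :
    (∀ φ : C₀(RelaxedCost.E d, ℝ),
      (RelaxedCost.IsOptimalDecomposition N ρ r ∧
          RelaxedCost.IsOptimal (RelaxedCost.dualValue N ρ) φ) ↔
        RelaxedCost.OptimalityConditions N r φ) ∧
    (∀ φ : ℕ → C₀(RelaxedCost.E d, ℝ),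
      (RelaxedCost.relaxedCost N ρ ≠ ∞ →
        (RelaxedCost.IsOptimalDecomposition N ρ r ∧
          RelaxedCost.IsMaximizing (RelaxedCost.dualValue N ρ) φ) →
        RelaxedCost.AsymptoticOptimalityConditions N r φ) ∧
      (RelaxedCost.AsymptoticOptimalityConditions N r φ →
        RelaxedCost.IsOptimalDecomposition N ρ r ∧
          RelaxedCost.IsMaximizing (RelaxedCost.dualValue N ρ) φ)) := by
  -- For `N = 0` the bound `1 / N` would be `∞`.
  have hN : 1 ≤ N := by
    rcases Nat.eq_zero_or_pos N with rfl | h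
    · simp at hρN
    · exact h
  have : Nonempty (Fin d) := ⟨⟨0, hd⟩⟩
  have : Nontrivial (RelaxedCost.E d) := inferInstance
  refine ⟨fun φ => ⟨fun h => ?_, fun h => ?_⟩, fun φ => ⟨fun hfin h => ?_, fun h =>
    RelaxedCost.isOptimalDecomposition_of_conditions hN hr h⟩⟩
  -- An optimal potential itself bounds the dual values, so part (a) needs no finiteness of the
  -- relaxed cost.
  · exact RelaxedCost.optimalityConditions_iff.2
      (RelaxedCost.conditions_of_isOptimalDecomposition hN hρ hρN h.1
        (RelaxedCost.isMaximizing_const_iff.2 h.2) ⟨_, Set.forall_mem_range.2 h.2⟩)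
  · have h1 := RelaxedCost.isOptimalDecomposition_of_conditions hN hr
      (RelaxedCost.optimalityConditions_iff.1 h)
    exact ⟨h1.1, RelaxedCost.isMaximizing_const_iff.1 h1.2⟩
  · refine RelaxedCost.conditions_of_isOptimalDecomposition hN hρ hρN h.1 h.2
      ⟨(RelaxedCost.relaxedCost N ρ).toReal, Set.forall_mem_range.2 fun ψ => ?_⟩
    exact (ENNReal.ofReal_le_iff_le_toReal hfin).1 (RelaxedCost.dualValue_le_relaxedCost hN ψ)
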